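/- Let $D\subset\mathbb R^3$ be a bounded domain (open, connected) with polytopal boundary, $D=\operatorname{int}\overline D$, and let $\mathcal T_h$ be a finite conforming triangulation of $\overline D$ into tetrahedra. For $K\in\mathcal T_h$ let $b_K$ be the product of its four barycentric coordinates. Write $\langle\cdot,\cdot\rangle$ for the $L^2(D)$ inner product. Define $$\begin{aligned} V_h^0&=\{v\in C^0(\overline D;\mathbb R^3): v|_K\in P_1(K)^3\oplus b_K\mathbb R^3\ \ \forall K\in\mathcal T_h\}\cap H^1_0(D)^3,\\ Q_h^0&=\{q\in C^0(\overline D): q|_K\in P_1(K)\ \ \forall K\in\mathcal T_h,\ \textstyle\int_D q=0\},\\ RT_h^0&=\{v\in H_0(\mathrm{div}): v|_K\in\{a+c\,x: a\in\mathbb R^3,\ c\in\mathbb R\}\ \ \forall K\in\mathcal T_h\},\\ X_h^0&=\{v\in H_0(\mathrm{curl}): v|_K\in\{a+x\times b: a,b\in\mathbb R^3\}\ \ \forall K\in\mathcal T_h\},\\ Y_h&=V_h^0\times Q_h^0\times RT_h^0\times X_h^0\times X_h^0 , \end{aligned}$$ where $H_0^1$, $H_0(\mathrm{div})$, $H_0(\mathrm{curl})$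 are the subspaces of $H^1$, $H(\mathrm{div})$, $H(\mathrm{curl})$ with zero standard, normal, tangential trace. Let $\alpha_1,\alpha_2,\sigma\ge 0$, $\nu,\eta>0$, let $\tau>0$ be the time step, $N$ the number of time steps, and $\mathrm d_\tau v^n=(v^n-v^{n-1})/\tau$. For $n=1,\dots,N$ and given $(u_h^{n-1},p_h^{n-1},B_h^{n-1},E_h^{n-1},J_h^{n-1})\in Y_h$, there exists a unique $(u_h^n,p_h^n,B_h^n,E_h^n,J_h^n)\in Y_h$ such that for all $(\phi,q,\psi,\chi,\omega)\in Y_h$ $$\begin{aligned} &\langle \mathrm d_\tau u_h^n,\phi\rangle+\alpha_1\langle\nabla \mathrm d_\tau u_h^n,\nabla\phi\rangle+\nu\langle\nabla u_h^n,\nabla\phi\rangle+\tfrac12\big[\langle(u_h^{n-1}\cdot\nabla)u_h^n,\phi\rangle-\langle(u_h^{n-1}\cdot\nabla)\phi,u_h^n\rangle\big]\\ &\qquad-\langle p_h^n,\mathrm{div}\,\phi\rangle-\langle J_h^n\times B_h^{n-1},\phi\rangle=0,\\ &\langle \mathrm d_\tau B_h^n,\psi\rangle+\langle\mathrm{curl}\,E_h^n,\psi\rangle=0,\\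 &\alpha_2\langle \mathrm d_\tau J_h^n,\chi\rangle+\sigma\langle J_h^n,\chi\rangle+\eta\langle J_h^n\times B_h^{n-1},\chi\rangle=\langle E_h^n,\chi\rangle+\langle u_h^n\times B_h^{n-1},\chi\rangle,\\ &\langle J_h^n,\omega\rangle-\langle B_h^n,\mathrm{curl}\,\omega\rangle=0,\\ &\langle\mathrm{div}\,u_h^n,q\rangle=0 . \end{aligned}$$ Furthermore, if the scheme is started from any element of $Y_h$ with magnetic component $B_h^0$ and run for $N$ steps, then $\mathrm{div}\,B_h^n=\mathrm{div}\,B_h^0$ for $n=1,\dots,N$. In particular, $\mathrm{div}\,B_h^n=0$ if $\mathrm{div}\,B_h^0=0$. -/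

import Mathlib

open MeasureTheory
open scoped ContDiff

noncomputable section

namespace HallMHD

/-- Euclidean three-space, as space of points and as space of vectors. -/
abbrev Vec : Type := EuclideanSpace ℝ (Fin 3)

/-- The cross product of Euclidean three-space. -/
def cross (a b : Vec) : Vec := WithLp.toLp 2 (crossProduct (WithLp.ofLp a) (WithLp.ofLp b))

/-- The `i`-th coordinate vector. -/
def basisVec (i : Fin 3) : Vec := EuclideanSpace.single i 1

/-- The space `L²(D; F)`; its inner product is the `L²` inner product. -/
abbrev LTwo (D : Set Vec) (F : Type) [NormedAddCommGroup F] : Type :=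
  Lp F 2 (volume.restrict D)

/-! ### Classical derivatives of smooth test fields -/

/-- The classical partial derivative `∂ᵢ φ (x)`. -/
def partialAt {F : Type} [NormedAddCommGroup F] [NormedSpace ℝ F]
    (i : Fin 3) (φ : Vec → F) (x : Vec) : F :=
  fderiv ℝ φ x (basisVec i)

/-- The classical gradient `∇φ (x)` of a scalar function. -/
def gradAt (φ : Vec → ℝ) (x : Vec) : Vec :=
  WithLp.toLp 2 (fun i => partialAt i φ x)

/-- The classical curl of a vector field. -/
def curlAt (φ : Vec → Vec) (x : Vec) : Vec :=
  !₂[partialAt 1 φ x 2 - partialAt 2 φ x 1,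
     partialAt 2 φ x 0 - partialAt 0 φ x 2,
     partialAt 0 φ x 1 - partialAt 1 φ x 0]

/-- `φ ∈ C_c^∞(ℝ³; F)`. -/
def IsSmoothCompact {F : Type} [NormedAddCommGroup F] [NormedSpace ℝ F] (φ : Vec → F) : Prop :=
  ContDiff ℝ ∞ φ ∧ HasCompactSupport φ

/-- `φ ∈ C_c^∞(D; F)`. -/
def IsTest {F : Type} [NormedAddCommGroup F] [NormedSpace ℝ F] (D : Set Vec) (φ : Vec → F) : Prop :=
  IsSmoothCompact φ ∧ tsupport φ ⊆ D

/-! ### Weak derivatives -/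

/-- `w = ∂ᵢ u` weakly in `D`. -/
def IsWeakPartial {F : Type} [NormedAddCommGroup F] [NormedSpace ℝ F]
    (D : Set Vec) (i : Fin 3) (u w : LTwo D F) : Prop :=
  ∀ φ : Vec → ℝ, IsTest D φ →
    ∫ x in D, φ x • w x = - ∫ x in D, partialAt i φ x • u x

/-- `w = div v` weakly in `D`. -/
def IsWeakDiv (D : Set Vec) (v : LTwo D Vec) (w : LTwo D ℝ) : Prop :=
  ∀ φ : Vec → ℝ, IsTest D φ →
    ∫ x in D, w x * φ x = - ∫ x in D, inner ℝ (v x) (gradAt φ x)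

/-- `w = curl v` weakly in `D`. -/
def IsWeakCurl (D : Set Vec) (v w : LTwo D Vec) : Prop :=
  ∀ φ : Vec → Vec, IsTest D φ →
    ∫ x in D, inner ℝ (w x) (φ x) = ∫ x in D, inner ℝ (v x) (curlAt φ x)

/-- Sobolev space `H¹(D; F)`. -/
def HOne {F : Type} [NormedAddCommGroup F] [NormedSpace ℝ F] (D : Set Vec) : Set (LTwo D F) :=
  {u | ∀ i, ∃ w, IsWeakPartial D i u w}

/-- The space `H(div)`. -/
def HDiv (D : Set Vec) : Set (LTwo D Vec) := {v | ∃ w, IsWeakDiv D v w}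

/-- The space `H(curl)`. -/
def HCurl (D : Set Vec) : Set (LTwo D Vec) := {v | ∃ w, IsWeakCurl D v w}

open Classical in
/-- The weak partial derivative `∂ᵢ u ∈ L²` of `u ∈ H¹` (and `0` outside the domain of `∂ᵢ`). -/
def weakPartial {F : Type} [NormedAddCommGroup F] [NormedSpace ℝ F]
    (D : Set Vec) (i : Fin 3) (u : LTwo D F) : LTwo D F :=
  if h : ∃ w, IsWeakPartial D i u w then h.choose else 0

open Classical in
/-- The weak divergence `div v ∈ L²` of `v ∈ H(div)` (and `0` outside `H(div)`). -/
def weakDiv (D : Set Vec) (v : LTwo D Vec) : LTwo D ℝ :=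
  if h : ∃ w, IsWeakDiv D v w then h.choose else 0

open Classical in
/-- The weak curl `curl v ∈ L²` of `v ∈ H(curl)` (and `0` outside `H(curl)`). -/
def weakCurl (D : Set Vec) (v : LTwo D Vec) : LTwo D Vec :=
  if h : ∃ w, IsWeakCurl D v w then h.choose else 0

/-! ### Vanishing traces

The trace of `u` on the boundary is the functional on smooth fields of the closed domain which
Green's formula defines; the trace vanishes when Green's formula holds without boundary term. -/

/-- `H¹₀(D; F)`: the functions in `H¹` with zero trace. -/
def HOneZero {F : Type} [NormedAddCommGroup F] [NormedSpace ℝ F] (D : Set Vec) : Set (LTwo D F) :=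
  {u | u ∈ HOne D ∧ ∀ i, ∀ φ : Vec → ℝ, IsSmoothCompact φ →
    ∫ x in D, φ x • weakPartial D i u x = - ∫ x in D, partialAt i φ x • u x}

/-- `H₀(div)`: the fields in `H(div)` with zero normal trace. -/
def HDivZero (D : Set Vec) : Set (LTwo D Vec) :=
  {v | v ∈ HDiv D ∧ ∀ φ : Vec → ℝ, IsSmoothCompact φ →
    ∫ x in D, weakDiv D v x * φ x = - ∫ x in D, inner ℝ (v x) (gradAt φ x)}

/-- `H₀(curl)`: the fields in `H(curl)` with zero tangential trace. -/
def HCurlZero (D : Set Vec) : Set (LTwo D Vec) :=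
  {v | v ∈ HCurl D ∧ ∀ φ : Vec → Vec, IsSmoothCompact φ →
    ∫ x in D, inner ℝ (weakCurl D v x) (φ x) = ∫ x in D, inner ℝ (v x) (curlAt φ x)}

/-! ### Meshes -/

/-- The cells of a mesh are its tetrahedra, given by their four vertices. -/
def IsCell (𝒯 : Geometry.SimplicialComplex ℝ Vec) (K : Finset Vec) : Prop :=
  K ∈ 𝒯.faces ∧ K.card = 4

/-- `𝒯` is a (conforming, finite) triangulation of the closure of `D` into tetrahedra. -/
structure IsTriangulation (D : Set Vec) (𝒯 : Geometry.SimplicialComplex ℝ Vec) : Prop where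
  finite : 𝒯.faces.Finite
  /-- every face is a face of a tetrahedron of the mesh -/
  pure : ∀ s ∈ 𝒯.faces, ∃ K, IsCell 𝒯 K ∧ s ⊆ K
  space_eq : 𝒯.space = closure D

/-- The four vertices of a cell, as an affine basis of three-space. -/
def cellBasis {𝒯 : Geometry.SimplicialComplex ℝ Vec} {K : Finset Vec} (hK : IsCell 𝒯 K) :
    AffineBasis K ℝ Vec :=
  ⟨((↑) : K → Vec), 𝒯.indep hK.1, by
    rw [(𝒯.indep hK.1).affineSpan_eq_top_iff_card_eq_finrank_add_one]
    simp [hK.2]⟩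

/-- The bubble function of a cell: the product of its barycentric coordinates. -/
def bubble {𝒯 : Geometry.SimplicialComplex ℝ Vec} {K : Finset Vec} (hK : IsCell 𝒯 K)
    (x : Vec) : ℝ :=
  ∏ v : K, (cellBasis hK).coord v x

/-! ### Finite element spaces -/

/-- MINI velocity space: continuous on the closed domain, on each cell an affine field plus a
constant vector times the bubble. -/
def VSpace (D : Set Vec) (𝒯 : Geometry.SimplicialComplex ℝ Vec) : Set (LTwo D Vec) :=
  {v | ∃ g : Vec → Vec, ContinuousOn g (closure D) ∧ (∀ᵐ x ∂(volume.restrict D), v x = g x) ∧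
    ∀ (K : Finset Vec) (hK : IsCell 𝒯 K), ∃ (A : Vec →ᵃ[ℝ] Vec) (c : Vec),
      ∀ x ∈ convexHull ℝ (K : Set Vec), g x = A x + bubble hK x • c}

/-- Pressure space: continuous on the closed domain, affine on each cell. -/
def QSpace (D : Set Vec) (𝒯 : Geometry.SimplicialComplex ℝ Vec) : Set (LTwo D ℝ) :=
  {q | ∃ g : Vec → ℝ, ContinuousOn g (closure D) ∧ (∀ᵐ x ∂(volume.restrict D), q x = g x) ∧
    ∀ K, IsCell 𝒯 K → ∃ A : Vec →ᵃ[ℝ] ℝ, ∀ x ∈ convexHull ℝ (K : Set Vec), g x = A x}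

/-- Lowest-order Nédélec space: fields in `H(curl)` of the form `a + x × b` on each cell. -/
def XSpace (D : Set Vec) (𝒯 : Geometry.SimplicialComplex ℝ Vec) : Set (LTwo D Vec) :=
  {v | v ∈ HCurl D ∧ ∀ K, IsCell 𝒯 K → ∃ a b : Vec,
    ∀ᵐ x ∂(volume.restrict D), x ∈ convexHull ℝ (K : Set Vec) → v x = a + cross x b}

/-- Lowest-order Raviart-Thomas space: fields in `H(div)` of the form `a + c x` on each cell. -/
def RTSpace (D : Set Vec) (𝒯 : Geometry.SimplicialComplex ℝ Vec) : Set (LTwo D Vec) :=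
  {v | v ∈ HDiv D ∧ ∀ K, IsCell 𝒯 K → ∃ (a : Vec) (c : ℝ),
    ∀ᵐ x ∂(volume.restrict D), x ∈ convexHull ℝ (K : Set Vec) → v x = a + c • x}

/-- The velocity space with zero trace. -/
def VZero (D : Set Vec) (𝒯 : Geometry.SimplicialComplex ℝ Vec) : Set (LTwo D Vec) :=
  VSpace D 𝒯 ∩ HOneZero D

/-- The pressure space with zero average. -/
def QZero (D : Set Vec) (𝒯 : Geometry.SimplicialComplex ℝ Vec) : Set (LTwo D ℝ) :=
  {q | q ∈ QSpace D 𝒯 ∧ ∫ x in D, q x = 0}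

/-- The Nédélec space with zero tangential trace. -/
def XZero (D : Set Vec) (𝒯 : Geometry.SimplicialComplex ℝ Vec) : Set (LTwo D Vec) :=
  XSpace D 𝒯 ∩ HCurlZero D

/-- The Raviart-Thomas space with zero normal trace. -/
def RTZero (D : Set Vec) (𝒯 : Geometry.SimplicialComplex ℝ Vec) : Set (LTwo D Vec) :=
  RTSpace D 𝒯 ∩ HDivZero D

/-! ### The scheme -/

/-- Velocity, pressure, magnetic field, electric field and current density at one time. -/
@[ext]
structure State (D : Set Vec) where
  u : LTwo D Vec
  p : LTwo D ℝ
  B : LTwo D Vec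
  E : LTwo D Vec
  J : LTwo D Vec

/-- The product space `Y_h`. -/
def YSpace (D : Set Vec) (𝒯 : Geometry.SimplicialComplex ℝ Vec) : Set (State D) :=
  {s | s.u ∈ VZero D 𝒯 ∧ s.p ∈ QZero D 𝒯 ∧ s.B ∈ RTZero D 𝒯 ∧ s.E ∈ XZero D 𝒯 ∧ s.J ∈ XZero D 𝒯}

/-- `⟨∇u, ∇v⟩`. -/
def gradInner (D : Set Vec) (u v : LTwo D Vec) : ℝ :=
  ∑ i, inner ℝ (weakPartial D i u) (weakPartial D i v)

/-- `⟨(w · ∇) u, v⟩`. -/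
def convect (D : Set Vec) (w u v : LTwo D Vec) : ℝ :=
  ∫ x in D, inner ℝ (∑ i, w x i • weakPartial D i u x) (v x)

/-- `⟨a × b, v⟩`. -/
def crossInner (D : Set Vec) (a b v : LTwo D Vec) : ℝ :=
  ∫ x in D, inner ℝ (cross (a x) (b x)) (v x)

/-- The backward difference quotient. -/
def diffQuot {D : Set Vec} (τ : ℝ) (new old : LTwo D Vec) : LTwo D Vec :=
  τ⁻¹ • (new - old)

/-- `new` solves the linear system of one time step, with data `old` of the previous time. -/
structure SolvesStep (D : Set Vec) (𝒯 : Geometry.SimplicialComplex ℝ Vec)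
    (α₁ α₂ ν σ η τ : ℝ) (old new : State D) : Prop where
  momentum : ∀ φ ∈ VZero D 𝒯,
    inner ℝ (diffQuot τ new.u old.u) φ + α₁ * gradInner D (diffQuot τ new.u old.u) φ
      + ν * gradInner D new.u φ
      + 1 / 2 * (convect D old.u new.u φ - convect D old.u φ new.u)
      - inner ℝ new.p (weakDiv D φ) - crossInner D new.J old.B φ = 0
  induction : ∀ ψ ∈ RTZero D 𝒯,
    inner ℝ (diffQuot τ new.B old.B) ψ + inner ℝ (weakCurl D new.E) ψ = 0
  ohm : ∀ χ ∈ XZero D 𝒯,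
    α₂ * inner ℝ (diffQuot τ new.J old.J) χ + σ * inner ℝ new.J χ
      + η * crossInner D new.J old.B χ
      = inner ℝ new.E χ + crossInner D new.u old.B χ
  ampere : ∀ ξ ∈ XZero D 𝒯,
    inner ℝ new.J ξ - inner ℝ new.B (weakCurl D ξ) = 0
  incompressible : ∀ q ∈ QZero D 𝒯,
    inner ℝ (weakDiv D new.u) q = 0

end HallMHD

end

open HallMHD

/-! One time step is a square linear system in finite dimension: each unknown space is paired with a
test space equal to it (`X` twice, for Ohm and Ampère). Hence existence and uniqueness both follow
once the homogeneous system has only the zero solution (`existsUnique_solution`,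
`eq_zero_of_homogeneous`).

For the homogeneous system, test with u, B, J, E and the pressure. The convection term is
antisymmetric, the Hall term vanishes because (J × B)·J = 0, the Lorentz force cancels against u × B
in Ohm's law, and the Ampère equation cancels the E–J coupling against the curl term. What remains
is a sum of nonnegative terms containing |u|²/τ and |B|²/τ, so u = B = 0. Ampère's law then gives J
= 0 and Ohm's law gives E = 0, even if α₂ = σ = 0.

Only ⟨p, div φ⟩ = 0 for all discrete φ is left. The bubbles settle it
(`eq_zero_of_orthogonal_weakDiv`): with φ = b_K eᵢ, integration by parts gives ∂ᵢp|_K ∫ b_K = 0, so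
p is constant on each cell. A continuous, piecewise constant function on a connected domain is
constant, and zero mean makes it 0.

For the divergence, the curl of a Nédélec field is piecewise constant, divergence-free and has zero
normal trace, so it lies in the Raviart–Thomas space (`weakCurl_mem_RTZero`). The induction equation
may then be tested with its own residual and holds strongly, B_new = B_old − τ curl E, and div curl
= 0. -/

noncomputable section

namespace HallMHD

section

/-! ### Linearity of the integral pairings on L² -/

section Pairing

variable {D : Set Vec} {F : Type} [NormedAddCommGroup F]

theorem integral_smul_add [NormedSpace ℝ F] {ψ : Vec → ℝ} (hψ : MemLp ψ 2 (volume.restrict D))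
    (u v : LTwo D F) :
    ∫ x in D, ψ x • (u + v) x = (∫ x in D, ψ x • u x) + ∫ x in D, ψ x • v x := by
  have h : ∀ w : LTwo D F, Integrable (fun x => ψ x • w x) (volume.restrict D) := fun w =>
    memLp_one_iff_integrable.1 (MemLp.smul (Lp.memLp w) hψ)
  rw [← integral_add (h u) (h v)]
  refine integral_congr_ae ?_
  filter_upwards [Lp.coeFn_add u v] with x hx
  rw [hx, Pi.add_apply, smul_add]

theorem integral_smul_const_smul [NormedSpace ℝ F] (ψ : Vec → ℝ) (c : ℝ) (u : LTwo D F) :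
    ∫ x in D, ψ x • (c • u) x = c • ∫ x in D, ψ x • u x := by
  rw [← integral_smul]
  refine integral_congr_ae ?_
  filter_upwards [Lp.coeFn_smul c u] with x hx
  rw [hx, Pi.smul_apply, smul_comm]

theorem integrable_inner_memLp [InnerProductSpace ℝ F] {ψ : Vec → F}
    (hψ : MemLp ψ 2 (volume.restrict D)) (u : LTwo D F) :
    Integrable (fun x => inner ℝ (u x) (ψ x)) (volume.restrict D) := by
  refine (L2.integrable_inner (𝕜 := ℝ) u hψ.toLp).congr ?_
  filter_upwards [hψ.coeFn_toLp] with x hx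
  rw [hx]

theorem integral_inner_add [InnerProductSpace ℝ F] {ψ : Vec → F}
    (hψ : MemLp ψ 2 (volume.restrict D)) (u v : LTwo D F) :
    ∫ x in D, inner ℝ ((u + v) x) (ψ x)
      = (∫ x in D, inner ℝ (u x) (ψ x)) + ∫ x in D, inner ℝ (v x) (ψ x) := by
  rw [← integral_add (integrable_inner_memLp hψ u) (integrable_inner_memLp hψ v)]
  refine integral_congr_ae ?_
  filter_upwards [Lp.coeFn_add u v] with x hx
  rw [hx, Pi.add_apply, inner_add_left]

theorem integral_inner_const_smul [InnerProductSpace ℝ F] (ψ : Vec → F) (c : ℝ) (u : LTwo D F) :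
    ∫ x in D, inner ℝ ((c • u) x) (ψ x) = c * ∫ x in D, inner ℝ (u x) (ψ x) := by
  rw [← integral_const_mul]
  refine integral_congr_ae ?_
  filter_upwards [Lp.coeFn_smul c u] with x hx
  rw [hx, Pi.smul_apply, real_inner_smul_left]

theorem integral_mul_add {ψ : Vec → ℝ} (hψ : MemLp ψ 2 (volume.restrict D)) (u v : LTwo D ℝ) :
    ∫ x in D, (u + v) x * ψ x = (∫ x in D, u x * ψ x) + ∫ x in D, v x * ψ x := by
  simpa only [smul_eq_mul, mul_comm] using integral_smul_add hψ u v

theorem integral_mul_const_smul (ψ : Vec → ℝ) (c : ℝ) (u : LTwo D ℝ) :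
    ∫ x in D, (c • u) x * ψ x = c * ∫ x in D, u x * ψ x := by
  simpa only [smul_eq_mul, mul_comm (ψ _)] using integral_smul_const_smul ψ c u

end Pairing

/-- The `j`-th coordinate functional of three-space. -/
def coordCLM (j : Fin 3) : Vec →L[ℝ] ℝ := EuclideanSpace.proj j

/-! ### Calculus of smooth test fields -/

section Smooth

variable {F : Type} [NormedAddCommGroup F] [NormedSpace ℝ F]

theorem IsSmoothCompact.memLp {φ : Vec → F} (hφ : IsSmoothCompact φ) (D : Set Vec) :
    MemLp φ 2 (volume.restrict D) :=
  hφ.1.continuous.memLp_of_hasCompactSupport hφ.2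

theorem IsSmoothCompact.differentiable {φ : Vec → F} (hφ : IsSmoothCompact φ) :
    Differentiable ℝ φ :=
  hφ.1.differentiable (by simp)

theorem IsSmoothCompact.partialAt {φ : Vec → F} (hφ : IsSmoothCompact φ) (i : Fin 3) :
    IsSmoothCompact (partialAt i φ) :=
  ⟨(hφ.1.fderiv_right (m := ∞) (by simp)).clm_apply contDiff_const,
    hφ.2.fderiv_apply (𝕜 := ℝ) (basisVec i)⟩

theorem IsSmoothCompact.coord {φ : Vec → Vec} (hφ : IsSmoothCompact φ) (j : Fin 3) :
    IsSmoothCompact (fun x => φ x j) :=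
  ⟨contDiff_euclidean.1 hφ.1 j, hφ.2.comp_left (g := fun v : Vec => v j) rfl⟩

theorem partialAt_coord {φ : Vec → Vec} {x : Vec} (hφ : DifferentiableAt ℝ φ x) (i j : Fin 3) :
    partialAt i φ x j = partialAt i (fun y => φ y j) x := by
  have h : fderiv ℝ (fun y => φ y j) x = (coordCLM j).comp (fderiv ℝ φ x) :=
    ((coordCLM j).hasFDerivAt.comp x hφ.hasFDerivAt).fderiv
  rw [partialAt, partialAt, h]; rfl

theorem partialAt_eq_zero {φ : Vec → F} {x : Vec} (hx : x ∉ tsupport φ) (i : Fin 3) :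
    partialAt i φ x = 0 := by
  have h : fderiv ℝ φ x = 0 := by
    by_contra h
    exact hx (support_fderiv_subset ℝ h)
  simp [partialAt, h]

theorem gradAt_eq_zero {φ : Vec → ℝ} {x : Vec} (hx : x ∉ tsupport φ) : gradAt φ x = 0 := by
  ext i; simp [gradAt, partialAt_eq_zero hx]

theorem curlAt_eq_zero {φ : Vec → Vec} {x : Vec} (hx : x ∉ tsupport φ) : curlAt φ x = 0 := by
  ext i; fin_cases i <;> simp [curlAt, partialAt_eq_zero hx]

theorem tsupport_gradAt_subset (φ : Vec → ℝ) : tsupport (gradAt φ) ⊆ tsupport φ :=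
  closure_minimal (fun _ hx => by_contra fun h => hx (gradAt_eq_zero h)) (isClosed_tsupport _)

theorem tsupport_curlAt_subset (φ : Vec → Vec) : tsupport (curlAt φ) ⊆ tsupport φ :=
  closure_minimal (fun _ hx => by_contra fun h => hx (curlAt_eq_zero h)) (isClosed_tsupport _)

theorem IsSmoothCompact.gradAt {φ : Vec → ℝ} (hφ : IsSmoothCompact φ) :
    IsSmoothCompact (gradAt φ) :=
  ⟨contDiff_euclidean.2 fun i => (hφ.partialAt i).1,
    hφ.2.of_isClosed_subset (isClosed_tsupport _) (tsupport_gradAt_subset φ)⟩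

theorem IsSmoothCompact.curlAt {φ : Vec → Vec} (hφ : IsSmoothCompact φ) :
    IsSmoothCompact (curlAt φ) := by
  have h := fun i j => contDiff_euclidean.1 (hφ.partialAt i).1 j
  refine ⟨contDiff_euclidean.2 fun i => ?_,
    hφ.2.of_isClosed_subset (isClosed_tsupport _) (tsupport_curlAt_subset φ)⟩
  fin_cases i
  · exact (h 1 2).sub (h 2 1)
  · exact (h 2 0).sub (h 0 2)
  · exact (h 0 1).sub (h 1 0)

theorem partialAt_comm {φ : Vec → ℝ} (hφ : ContDiff ℝ ∞ φ) (i j : Fin 3) (x : Vec) :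
    partialAt i (partialAt j φ) x = partialAt j (partialAt i φ) x := by
  have hd : DifferentiableAt ℝ (fderiv ℝ φ) x :=
    (hφ.fderiv_right (m := ∞) (by simp)).differentiable (by simp) x
  have h : ∀ k l, partialAt k (partialAt l φ) x
      = fderiv ℝ (fderiv ℝ φ) x (basisVec k) (basisVec l) := by
    intro k l
    have := (hd.hasFDerivAt.clm_apply (hasFDerivAt_const (basisVec l) x)).fderiv
    change fderiv ℝ (fun y => fderiv ℝ φ y (basisVec l)) x (basisVec k) = _
    rw [this]; simp
  rw [h, h]
  exact ((contDiff_infty.1 hφ 2).contDiffAt.isSymmSndFDerivAt (by simp)).eq _ _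

theorem curlAt_gradAt {φ : Vec → ℝ} (hφ : IsSmoothCompact φ) (x : Vec) :
    curlAt (gradAt φ) x = 0 := by
  have h : ∀ i j, partialAt i (gradAt φ) x j = partialAt i (partialAt j φ) x := fun i j =>
    partialAt_coord (hφ.gradAt.differentiable x) i j
  have hc := fun i j => partialAt_comm hφ.1 i j x
  ext k
  fin_cases k <;> simp [curlAt, h, hc 2 1, hc 2 0, hc 1 0]

/-- Integration by parts against a smooth compactly supported function. -/
theorem integral_mul_partialAt {f ψ : Vec → ℝ} (hf : ContDiff ℝ 1 f) (hψ : IsSmoothCompact ψ)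
    (i : Fin 3) : ∫ x, f x * partialAt i ψ x = - ∫ x, partialAt i f x * ψ x := by
  have hi : ∀ g : Vec → ℝ, ∀ χ : Vec → ℝ, Continuous g → IsSmoothCompact χ →
      Integrable (fun x => g x * χ x) := fun g χ hg hχ =>
    (hg.mul hχ.1.continuous).integrable_of_hasCompactSupport hχ.2.mul_left
  refine integral_mul_fderiv_eq_neg_fderiv_mul_of_integrable (hi _ _ ?_ hψ)
    (hi _ _ hf.continuous (hψ.partialAt i)) (hi _ _ hf.continuous hψ)
    (fun x _ => hf.differentiable (by simp) x) (fun x _ => hψ.differentiable x)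
  exact (hf.continuous_fderiv (by simp)).clm_apply continuous_const

end Smooth

/-! ### Weak partial derivatives and H¹₀ -/

section WeakPartial

variable {D : Set Vec} {F : Type} [NormedAddCommGroup F] [NormedSpace ℝ F]

/-- The fundamental lemma of the calculus of variations. `U` is kept separate from `D` so that it
can also be applied in the interior of a single cell. -/
theorem ae_eq_zero_of_test [CompleteSpace F] (w : LTwo D F) {U : Set Vec} (hU : IsOpen U)
    (h : ∀ φ : Vec → ℝ, IsTest U φ → ∫ x in D, φ x • w x = 0) :
    ∀ᵐ x ∂(volume.restrict D), x ∈ U → w x = 0 := by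
  have hloc : LocallyIntegrable w (volume.restrict D) :=
    (Lp.memLp w).locallyIntegrable (by norm_num)
  exact hU.ae_eq_zero_of_integral_contDiff_smul_eq_zero (hloc.locallyIntegrableOn U)
    fun g h1 h2 h3 => h g ⟨⟨h1, h2⟩, h3⟩

theorem eq_zero_of_test [CompleteSpace F] (hD : IsOpen D) (w : LTwo D F)
    (h : ∀ φ : Vec → ℝ, IsTest D φ → ∫ x in D, φ x • w x = 0) : w = 0 := by
  refine Lp.ext ?_
  filter_upwards [ae_eq_zero_of_test w hD h, ae_restrict_mem hD.measurableSet,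
    Lp.coeFn_zero F 2 (volume.restrict D)] with x h1 h2 h3
  rw [h1 h2, h3]; rfl

theorem partial_pairing_add {i : Fin 3} {φ : Vec → ℝ} (hφ : IsSmoothCompact φ)
    {u w u' w' : LTwo D F}
    (h : ∫ x in D, φ x • w x = - ∫ x in D, partialAt i φ x • u x)
    (h' : ∫ x in D, φ x • w' x = - ∫ x in D, partialAt i φ x • u' x) :
    ∫ x in D, φ x • (w + w') x = - ∫ x in D, partialAt i φ x • (u + u') x := by
  rw [integral_smul_add (hφ.memLp D), integral_smul_add ((hφ.partialAt i).memLp D), h, h',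
    neg_add]

theorem partial_pairing_smul {i : Fin 3} {φ : Vec → ℝ} (c : ℝ) {u w : LTwo D F}
    (h : ∫ x in D, φ x • w x = - ∫ x in D, partialAt i φ x • u x) :
    ∫ x in D, φ x • (c • w) x = - ∫ x in D, partialAt i φ x • (c • u) x := by
  rw [integral_smul_const_smul, integral_smul_const_smul, h, smul_neg]

theorem IsWeakPartial.unique [CompleteSpace F] (hD : IsOpen D) {i : Fin 3} {u w w' : LTwo D F}
    (h : IsWeakPartial D i u w) (h' : IsWeakPartial D i u w') : w = w' := by
  rw [← sub_eq_zero]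
  refine eq_zero_of_test hD _ fun φ hφ => ?_
  rw [show w - w' = w + (-1 : ℝ) • w' by module, integral_smul_add (hφ.1.memLp D),
    integral_smul_const_smul, h φ hφ, h' φ hφ]
  module

/-- Uniqueness makes the choice inside `weakPartial` immaterial: exhibiting any weak derivative
computes it. -/
theorem weakPartial_eq [CompleteSpace F] (hD : IsOpen D) {i : Fin 3} {u w : LTwo D F}
    (h : IsWeakPartial D i u w) : weakPartial D i u = w := by
  have hex : ∃ w, IsWeakPartial D i u w := ⟨w, h⟩
  rw [weakPartial, dif_pos hex]
  exact hex.choose_spec.unique hD h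

theorem isWeakPartial_weakPartial {i : Fin 3} {u : LTwo D F} (hu : u ∈ HOne D) :
    IsWeakPartial D i u (weakPartial D i u) := by
  rw [weakPartial, dif_pos (hu i)]
  exact (hu i).choose_spec

theorem weakPartial_add [CompleteSpace F] (hD : IsOpen D) (i : Fin 3) {u v : LTwo D F}
    (hu : u ∈ HOne D) (hv : v ∈ HOne D) :
    weakPartial D i (u + v) = weakPartial D i u + weakPartial D i v :=
  weakPartial_eq hD fun φ hφ => partial_pairing_add hφ.1
    (isWeakPartial_weakPartial hu φ hφ) (isWeakPartial_weakPartial hv φ hφ)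

theorem weakPartial_smul [CompleteSpace F] (hD : IsOpen D) (i : Fin 3) (c : ℝ) {u : LTwo D F}
    (hu : u ∈ HOne D) : weakPartial D i (c • u) = c • weakPartial D i u :=
  weakPartial_eq hD fun φ hφ => partial_pairing_smul c (isWeakPartial_weakPartial hu φ hφ)

/-- A candidate satisfying Green's formula against all smooth compactly supported functions is in
particular the weak derivative. This form avoids `weakPartial`, so closure under linear combinations
is immediate. -/
theorem mem_HOneZero_iff [CompleteSpace F] (hD : IsOpen D) {u : LTwo D F} :
    u ∈ HOneZero D ↔ ∀ i, ∃ w : LTwo D F, ∀ φ : Vec → ℝ, IsSmoothCompact φ →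
      ∫ x in D, φ x • w x = - ∫ x in D, partialAt i φ x • u x := by
  constructor
  · exact fun h i => ⟨_, h.2 i⟩
  · intro h
    refine ⟨fun i => ?_, fun i φ hφ => ?_⟩
    · obtain ⟨w, hw⟩ := h i
      exact ⟨w, fun φ hφ => hw φ hφ.1⟩
    · obtain ⟨w, hw⟩ := h i
      rw [weakPartial_eq hD (w := w) fun φ hφ => hw φ hφ.1]
      exact hw φ hφ

/-- `H¹₀(D; F)` as a subspace of `L²`. -/
def hOneZeroSubmodule [CompleteSpace F] (hD : IsOpen D) : Submodule ℝ (LTwo D F) where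
  carrier := HOneZero D
  zero_mem' := (mem_HOneZero_iff hD).2 fun i => ⟨0, fun φ hφ => by
    have h0 : ∀ ψ : Vec → ℝ, ∫ x in D, ψ x • (0 : LTwo D F) x = 0 := fun ψ => by
      simpa using integral_smul_const_smul ψ 0 (0 : LTwo D F)
    rw [h0, h0, neg_zero]⟩
  add_mem' := fun {u v} hu hv => (mem_HOneZero_iff hD).2 fun i =>
    ⟨_, fun φ hφ => partial_pairing_add hφ (hu.2 i φ hφ) (hv.2 i φ hφ)⟩
  smul_mem' := fun c u hu => (mem_HOneZero_iff hD).2 fun i =>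
    ⟨_, fun φ hφ => partial_pairing_smul c (hu.2 i φ hφ)⟩

end WeakPartial

/-! ### Weak divergence and H₀(div) -/

section WeakDiv

variable {D : Set Vec}

theorem div_pairing_add {φ : Vec → ℝ} (hφ : IsSmoothCompact φ) {v v' : LTwo D Vec}
    {w w' : LTwo D ℝ}
    (h : ∫ x in D, w x * φ x = - ∫ x in D, inner ℝ (v x) (gradAt φ x))
    (h' : ∫ x in D, w' x * φ x = - ∫ x in D, inner ℝ (v' x) (gradAt φ x)) :
    ∫ x in D, (w + w') x * φ x = - ∫ x in D, inner ℝ ((v + v') x) (gradAt φ x) := by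
  rw [integral_mul_add (hφ.memLp D), integral_inner_add (hφ.gradAt.memLp D), h, h', neg_add]

theorem div_pairing_smul {φ : Vec → ℝ} (c : ℝ) {v : LTwo D Vec} {w : LTwo D ℝ}
    (h : ∫ x in D, w x * φ x = - ∫ x in D, inner ℝ (v x) (gradAt φ x)) :
    ∫ x in D, (c • w) x * φ x = - ∫ x in D, inner ℝ ((c • v) x) (gradAt φ x) := by
  rw [integral_mul_const_smul, integral_inner_const_smul, h, mul_neg]

theorem IsWeakDiv.unique (hD : IsOpen D) {v : LTwo D Vec} {w w' : LTwo D ℝ}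
    (h : IsWeakDiv D v w) (h' : IsWeakDiv D v w') : w = w' := by
  rw [← sub_eq_zero]
  refine eq_zero_of_test hD _ fun φ hφ => ?_
  rw [show w - w' = w + (-1 : ℝ) • w' by module, integral_smul_add (hφ.1.memLp D),
    integral_smul_const_smul]
  have h1 := h φ hφ
  have h2 := h' φ hφ
  simp only [mul_comm _ (φ _)] at h1 h2
  simp only [smul_eq_mul]
  rw [h1, h2]; ring

theorem weakDiv_eq (hD : IsOpen D) {v : LTwo D Vec} {w : LTwo D ℝ}
    (h : IsWeakDiv D v w) : weakDiv D v = w := by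
  have hex : ∃ w, IsWeakDiv D v w := ⟨w, h⟩
  rw [weakDiv, dif_pos hex]
  exact hex.choose_spec.unique hD h

theorem isWeakDiv_weakDiv {v : LTwo D Vec} (hv : v ∈ HDiv D) : IsWeakDiv D v (weakDiv D v) := by
  have hex : ∃ w, IsWeakDiv D v w := hv
  rw [weakDiv, dif_pos hex]
  exact hex.choose_spec

theorem weakDiv_add (hD : IsOpen D) {u v : LTwo D Vec} (hu : u ∈ HDiv D) (hv : v ∈ HDiv D) :
    weakDiv D (u + v) = weakDiv D u + weakDiv D v :=
  weakDiv_eq hD fun φ hφ => div_pairing_add hφ.1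
    (isWeakDiv_weakDiv hu φ hφ) (isWeakDiv_weakDiv hv φ hφ)

theorem weakDiv_smul (hD : IsOpen D) (c : ℝ) {u : LTwo D Vec} (hu : u ∈ HDiv D) :
    weakDiv D (c • u) = c • weakDiv D u :=
  weakDiv_eq hD fun φ hφ => div_pairing_smul c (isWeakDiv_weakDiv hu φ hφ)

theorem mem_HDivZero_iff (hD : IsOpen D) {v : LTwo D Vec} :
    v ∈ HDivZero D ↔ ∃ w : LTwo D ℝ, ∀ φ : Vec → ℝ, IsSmoothCompact φ →
      ∫ x in D, w x * φ x = - ∫ x in D, inner ℝ (v x) (gradAt φ x) := by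
  constructor
  · exact fun h => ⟨_, h.2⟩
  · rintro ⟨w, hw⟩
    refine ⟨⟨w, fun φ hφ => hw φ hφ.1⟩, fun φ hφ => ?_⟩
    rw [weakDiv_eq hD (w := w) fun φ hφ => hw φ hφ.1]
    exact hw φ hφ

theorem weakDiv_eq_zero (hD : IsOpen D) {v : LTwo D Vec}
    (h : ∀ φ : Vec → ℝ, IsTest D φ → ∫ x in D, inner ℝ (v x) (gradAt φ x) = 0) :
    weakDiv D v = 0 := by
  refine weakDiv_eq hD fun φ hφ => ?_
  rw [h φ hφ, neg_zero]
  simpa using integral_mul_const_smul φ 0 (0 : LTwo D ℝ)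

/-- `H₀(div)` as a subspace of `L²`. -/
def hDivZeroSubmodule (hD : IsOpen D) : Submodule ℝ (LTwo D Vec) where
  carrier := HDivZero D
  zero_mem' := (mem_HDivZero_iff hD).2 ⟨0, fun φ _ => by
    have h1 := integral_mul_const_smul φ 0 (0 : LTwo D ℝ)
    have h2 := integral_inner_const_smul (gradAt φ) 0 (0 : LTwo D Vec)
    simp only [smul_zero, zero_mul] at h1 h2
    rw [h1, h2, neg_zero]⟩
  add_mem' := fun {u v} hu hv => (mem_HDivZero_iff hD).2
    ⟨_, fun φ hφ => div_pairing_add hφ (hu.2 φ hφ) (hv.2 φ hφ)⟩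
  smul_mem' := fun c u hu => (mem_HDivZero_iff hD).2
    ⟨_, fun φ hφ => div_pairing_smul c (hu.2 φ hφ)⟩

end WeakDiv

/-! ### Weak curl, H₀(curl), and div curl = 0 -/

section WeakCurl

variable {D : Set Vec}

theorem curl_pairing_add {φ : Vec → Vec} (hφ : IsSmoothCompact φ) {v v' w w' : LTwo D Vec}
    (h : ∫ x in D, inner ℝ (w x) (φ x) = ∫ x in D, inner ℝ (v x) (curlAt φ x))
    (h' : ∫ x in D, inner ℝ (w' x) (φ x) = ∫ x in D, inner ℝ (v' x) (curlAt φ x)) :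
    ∫ x in D, inner ℝ ((w + w') x) (φ x) = ∫ x in D, inner ℝ ((v + v') x) (curlAt φ x) := by
  rw [integral_inner_add (hφ.memLp D), integral_inner_add (hφ.curlAt.memLp D), h, h']

theorem curl_pairing_smul {φ : Vec → Vec} (c : ℝ) {v w : LTwo D Vec}
    (h : ∫ x in D, inner ℝ (w x) (φ x) = ∫ x in D, inner ℝ (v x) (curlAt φ x)) :
    ∫ x in D, inner ℝ ((c • w) x) (φ x) = ∫ x in D, inner ℝ ((c • v) x) (curlAt φ x) := by
  rw [integral_inner_const_smul, integral_inner_const_smul, h]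

/-- Vector tests of the form φ c, with c a constant vector, reduce this to the scalar case. -/
theorem ae_eq_zero_of_vector_test (w : LTwo D Vec) {U : Set Vec} (hU : IsOpen U)
    (h : ∀ φ : Vec → Vec, IsTest U φ → ∫ x in D, inner ℝ (w x) (φ x) = 0) :
    ∀ᵐ x ∂(volume.restrict D), x ∈ U → w x = 0 := by
  refine ae_eq_zero_of_test w hU fun φ hφ => ?_
  refine ext_inner_left ℝ fun c => ?_
  have hint : Integrable (fun x => φ x • w x) (volume.restrict D) :=
    memLp_one_iff_integrable.1 (MemLp.smul (Lp.memLp w) (hφ.1.memLp D))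
  rw [← integral_inner hint, inner_zero_right]
  have hc : IsTest U (fun x => φ x • c) :=
    ⟨⟨hφ.1.1.smul contDiff_const, hφ.1.2.smul_right⟩,
      (tsupport_smul_subset_left _ _).trans hφ.2⟩
  rw [← h _ hc]
  refine integral_congr_ae (.of_forall fun x => ?_)
  simp only [real_inner_smul_right, real_inner_comm c]

theorem IsWeakCurl.unique (hD : IsOpen D) {v w w' : LTwo D Vec}
    (h : IsWeakCurl D v w) (h' : IsWeakCurl D v w') : w = w' := by
  rw [← sub_eq_zero]
  have := ae_eq_zero_of_vector_test (w - w') hD fun φ hφ => by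
    rw [show w - w' = w + (-1 : ℝ) • w' by module, integral_inner_add (hφ.1.memLp D),
      integral_inner_const_smul, h φ hφ, h' φ hφ]
    ring
  refine Lp.ext ?_
  filter_upwards [this, ae_restrict_mem hD.measurableSet,
    Lp.coeFn_zero Vec 2 (volume.restrict D)] with x h1 h2 h3
  rw [h1 h2, h3]; rfl

theorem weakCurl_eq (hD : IsOpen D) {v w : LTwo D Vec} (h : IsWeakCurl D v w) :
    weakCurl D v = w := by
  have hex : ∃ w, IsWeakCurl D v w := ⟨w, h⟩
  rw [weakCurl, dif_pos hex]
  exact hex.choose_spec.unique hD h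

theorem isWeakCurl_weakCurl {v : LTwo D Vec} (hv : v ∈ HCurl D) :
    IsWeakCurl D v (weakCurl D v) := by
  have hex : ∃ w, IsWeakCurl D v w := hv
  rw [weakCurl, dif_pos hex]
  exact hex.choose_spec

theorem weakCurl_add (hD : IsOpen D) {u v : LTwo D Vec} (hu : u ∈ HCurl D) (hv : v ∈ HCurl D) :
    weakCurl D (u + v) = weakCurl D u + weakCurl D v :=
  weakCurl_eq hD fun φ hφ => curl_pairing_add hφ.1
    (isWeakCurl_weakCurl hu φ hφ) (isWeakCurl_weakCurl hv φ hφ)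

theorem weakCurl_smul (hD : IsOpen D) (c : ℝ) {u : LTwo D Vec} (hu : u ∈ HCurl D) :
    weakCurl D (c • u) = c • weakCurl D u :=
  weakCurl_eq hD fun φ hφ => curl_pairing_smul c (isWeakCurl_weakCurl hu φ hφ)

theorem mem_HCurlZero_iff (hD : IsOpen D) {v : LTwo D Vec} :
    v ∈ HCurlZero D ↔ ∃ w : LTwo D Vec, ∀ φ : Vec → Vec, IsSmoothCompact φ →
      ∫ x in D, inner ℝ (w x) (φ x) = ∫ x in D, inner ℝ (v x) (curlAt φ x) := by
  constructor
  · exact fun h => ⟨_, h.2⟩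
  · rintro ⟨w, hw⟩
    refine ⟨⟨w, fun φ hφ => hw φ hφ.1⟩, fun φ hφ => ?_⟩
    rw [weakCurl_eq hD (w := w) fun φ hφ => hw φ hφ.1]
    exact hw φ hφ

/-- `H₀(curl)` as a subspace of `L²`. -/
def hCurlZeroSubmodule (hD : IsOpen D) : Submodule ℝ (LTwo D Vec) where
  carrier := HCurlZero D
  zero_mem' := (mem_HCurlZero_iff hD).2 ⟨0, fun φ _ => by
    have h1 := integral_inner_const_smul φ 0 (0 : LTwo D Vec)
    have h2 := integral_inner_const_smul (curlAt φ) 0 (0 : LTwo D Vec)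
    simp only [smul_zero, zero_mul] at h1 h2
    rw [h1, h2]⟩
  add_mem' := fun {u v} hu hv => (mem_HCurlZero_iff hD).2
    ⟨_, fun φ hφ => curl_pairing_add hφ (hu.2 φ hφ) (hv.2 φ hφ)⟩
  smul_mem' := fun c u hu => (mem_HCurlZero_iff hD).2
    ⟨_, fun φ hφ => curl_pairing_smul c (hu.2 φ hφ)⟩

/-- The zero tangential trace admits ∇φ as a test field even when φ does not vanish on the boundary,
and curl ∇φ = 0. Hence curl v has zero normal trace as well as zero divergence. -/
theorem integral_inner_weakCurl_gradAt {v : LTwo D Vec} (hv : v ∈ HCurlZero D) {φ : Vec → ℝ}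
    (hφ : IsSmoothCompact φ) : ∫ x in D, inner ℝ (weakCurl D v x) (gradAt φ x) = 0 := by
  rw [hv.2 _ hφ.gradAt]
  simp [curlAt_gradAt hφ]

theorem weakDiv_weakCurl (hD : IsOpen D) {v : LTwo D Vec} (hv : v ∈ HCurlZero D) :
    weakDiv D (weakCurl D v) = 0 :=
  weakDiv_eq_zero hD fun _ hφ => integral_inner_weakCurl_gradAt hv hφ.1

theorem weakCurl_mem_HDivZero (hD : IsOpen D) {v : LTwo D Vec} (hv : v ∈ HCurlZero D) :
    weakCurl D v ∈ HDivZero D := by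
  refine (mem_HDivZero_iff hD).2 ⟨0, fun φ hφ => ?_⟩
  rw [integral_inner_weakCurl_gradAt hv hφ, neg_zero]
  simpa using integral_mul_const_smul φ 0 (0 : LTwo D ℝ)

/-- `H¹ ⊆ H(div)`. -/
theorem HOne_subset_HDiv : HOne D ⊆ HDiv D := by
  intro u hu
  have hm : ∀ i : Fin 3, MemLp (fun x => weakPartial D i u x i) 2 (volume.restrict D) := fun i =>
    (coordCLM i).comp_memLp'
      (Lp.memLp (weakPartial D i u))
  have hs : MemLp (fun x => ∑ i, weakPartial D i u x i) 2 (volume.restrict D) :=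
    memLp_finsetSum _ fun i _ => hm i
  have hi : ∀ {ψ : Vec → ℝ} (_ : IsSmoothCompact ψ) (w : LTwo D Vec),
      Integrable (fun x => ψ x • w x) (volume.restrict D) := fun hψ w =>
    memLp_one_iff_integrable.1 (MemLp.smul (Lp.memLp w) (hψ.memLp D))
  have hproj : ∀ {ψ : Vec → ℝ} (_ : IsSmoothCompact ψ) (w : LTwo D Vec) (i : Fin 3),
      ∫ x in D, ψ x * w x i = (∫ x in D, ψ x • w x) i := fun hψ w i =>
    (coordCLM i).integral_comp_comm (hi hψ w)
  have hpi : ∀ {ψ : Vec → ℝ} (_ : IsSmoothCompact ψ) (w : LTwo D Vec) (i : Fin 3),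
      Integrable (fun x => ψ x * w x i) (volume.restrict D) := fun hψ w i =>
    (coordCLM i).integrable_comp (hi hψ w)
  refine ⟨hs.toLp _, fun φ hφ => ?_⟩
  calc ∫ x in D, hs.toLp _ x * φ x = ∫ x in D, ∑ i, φ x * weakPartial D i u x i := by
        refine integral_congr_ae ?_
        filter_upwards [hs.coeFn_toLp] with x hx
        rw [hx, Finset.sum_mul]
        exact Finset.sum_congr rfl fun i _ => mul_comm _ _
    _ = ∑ i, (∫ x in D, φ x • weakPartial D i u x) i := by
        rw [integral_finsetSum _ fun i _ => hpi hφ.1 _ i]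
        exact Finset.sum_congr rfl fun i _ => hproj hφ.1 _ i
    _ = - ∑ i, (∫ x in D, partialAt i φ x • u x) i := by
        rw [← Finset.sum_neg_distrib]
        refine Finset.sum_congr rfl fun i _ => ?_
        rw [isWeakPartial_weakPartial hu φ hφ]; rfl
    _ = - ∫ x in D, ∑ i, partialAt i φ x * u x i := by
        rw [integral_finsetSum _ fun i _ => hpi (hφ.1.partialAt i) _ i]
        congr 1
        exact Finset.sum_congr rfl fun i _ => (hproj (hφ.1.partialAt i) _ i).symm
    _ = _ := by
        congr 1

end WeakCurl

end

section

/-! ### Consequences of a finite triangulation -/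

section Mesh

variable {D : Set Vec} {𝒯 : Geometry.SimplicialComplex ℝ Vec}

theorem IsTriangulation.finite_cells (h : IsTriangulation D 𝒯) :
    Finite {K : Finset Vec // IsCell 𝒯 K} :=
  (h.finite.subset fun _ hK => hK.1 : {K | IsCell 𝒯 K}.Finite).to_subtype

theorem IsTriangulation.hull_subset_closure (h : IsTriangulation D 𝒯) {K : Finset Vec}
    (hK : IsCell 𝒯 K) : convexHull ℝ (K : Set Vec) ⊆ closure D := by
  rw [← h.space_eq]
  exact 𝒯.convexHull_subset_space hK.1

/-- A cell a priori lies only in the closure of `D`; D = int D̄ makes fields supported inside a cell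
admissible on `D`. -/
theorem IsTriangulation.interior_hull_subset (h : IsTriangulation D 𝒯)
    (hreg : interior (closure D) = D) {K : Finset Vec} (hK : IsCell 𝒯 K) :
    interior (convexHull ℝ (K : Set Vec)) ⊆ D :=
  (interior_mono (h.hull_subset_closure hK)).trans hreg.subset

theorem IsTriangulation.exists_cell_mem (h : IsTriangulation D 𝒯) {x : Vec}
    (hx : x ∈ closure D) : ∃ K, IsCell 𝒯 K ∧ x ∈ convexHull ℝ (K : Set Vec) := by
  rw [← h.space_eq, 𝒯.mem_space_iff] at hx
  obtain ⟨s, hs, hxs⟩ := hx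
  obtain ⟨K, hK, hsK⟩ := h.pure s hs
  exact ⟨K, hK, convexHull_mono (by exact_mod_cast hsK) hxs⟩

theorem isCompact_hull (K : Finset Vec) : IsCompact (convexHull ℝ (K : Set Vec)) :=
  K.finite_toSet.isCompact_convexHull ℝ

theorem IsTriangulation.isCompact_closure (h : IsTriangulation D 𝒯) : IsCompact (closure D) := by
  have := h.finite_cells
  have hU : closure D = ⋃ K : {K : Finset Vec // IsCell 𝒯 K}, convexHull ℝ (K.1 : Set Vec) := by
    ext x
    constructor
    · intro hx
      obtain ⟨K, hK, hxK⟩ := h.exists_cell_mem hx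
      exact Set.mem_iUnion.2 ⟨⟨K, hK⟩, hxK⟩
    · intro hx
      obtain ⟨K, hxK⟩ := Set.mem_iUnion.1 hx
      exact h.hull_subset_closure K.2 hxK
  rw [hU]
  exact isCompact_iUnion fun K => isCompact_hull K.1

theorem IsTriangulation.isFiniteMeasure (h : IsTriangulation D 𝒯) :
    IsFiniteMeasure (volume.restrict D) :=
  ⟨by
    rw [Measure.restrict_apply_univ]
    exact (measure_mono subset_closure).trans_lt h.isCompact_closure.measure_lt_top⟩

/-- The frontier of a convex set is a null set. -/
theorem ae_mem_interior_hull (D : Set Vec) (K : Finset Vec) :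
    ∀ᵐ x ∂(volume.restrict D), x ∈ convexHull ℝ (K : Set Vec) →
      x ∈ interior (convexHull ℝ (K : Set Vec)) := by
  have h0 := (convex_convexHull ℝ (K : Set Vec)).addHaar_frontier volume
  filter_upwards [ae_restrict_of_ae (measure_eq_zero_iff_ae_notMem.1 h0)] with x hx hxK
  by_contra hxi
  exact hx ⟨subset_closure hxK, hxi⟩

variable {F : Type} [NormedAddCommGroup F]

theorem IsTriangulation.ae_bounded (h : IsTriangulation D 𝒯) (hD : IsOpen D) (v : LTwo D F)
    (hv : ∀ K, IsCell 𝒯 K → ∃ f : Vec → F, Continuous f ∧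
      ∀ᵐ x ∂(volume.restrict D), x ∈ convexHull ℝ (K : Set Vec) → v x = f x) :
    ∃ C, ∀ᵐ x ∂(volume.restrict D), ‖v x‖ ≤ C := by
  have := h.finite_cells
  have hb : ∀ K : {K : Finset Vec // IsCell 𝒯 K}, ∃ C, ∀ᵐ x ∂(volume.restrict D),
      x ∈ convexHull ℝ (K.1 : Set Vec) → ‖v x‖ ≤ C := by
    intro K
    obtain ⟨f, hf, hvf⟩ := hv K.1 K.2
    obtain ⟨C, hC⟩ := (isCompact_hull K.1).exists_bound_of_continuousOn hf.continuousOn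
    refine ⟨C, ?_⟩
    filter_upwards [hvf] with x hx hxK
    rw [hx hxK]
    exact hC x hxK
  choose C hC using hb
  obtain ⟨M, hM⟩ := (Set.finite_range C).bddAbove
  refine ⟨M, ?_⟩
  filter_upwards [ae_all_iff.2 hC, ae_restrict_mem hD.measurableSet] with x hx hxD
  obtain ⟨K, hK, hxK⟩ := h.exists_cell_mem (subset_closure hxD)
  exact (hx ⟨K, hK⟩ hxK).trans (hM ⟨⟨K, hK⟩, rfl⟩)

/-- A space of piecewise defined functions with finitely many parameters on each cell is
finite-dimensional. -/
theorem IsTriangulation.finiteDimensional_of_piecewise [NormedSpace ℝ F]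
    (h : IsTriangulation D 𝒯) (hD : IsOpen D) (V : Submodule ℝ (LTwo D F))
    {P : Type} [AddCommGroup P] [Module ℝ P] [FiniteDimensional ℝ P]
    (ev : {K : Finset Vec // IsCell 𝒯 K} → P →ₗ[ℝ] (Vec → F))
    (hV : ∀ v ∈ V, ∀ K : {K : Finset Vec // IsCell 𝒯 K}, ∃ p : P, ∀ᵐ x ∂(volume.restrict D),
      x ∈ convexHull ℝ (K.1 : Set Vec) → v x = ev K p x) :
    FiniteDimensional ℝ V := by
  have := h.finite_cells
  -- `S` relates cellwise parameters to the functions they represent. Its projection to the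
  -- parameters is injective because the cells cover `D`, and its projection to functions contains
  -- `V`. The parameters of a function need not be unique.
  let S : Submodule ℝ (({K : Finset Vec // IsCell 𝒯 K} → P) × LTwo D F) :=
    { carrier := {s | ∀ K, ∀ᵐ x ∂(volume.restrict D),
        x ∈ convexHull ℝ (K.1 : Set Vec) → s.2 x = ev K (s.1 K) x}
      zero_mem' := fun K => by
        filter_upwards [Lp.coeFn_zero F 2 (volume.restrict D)] with x hx _
        exact hx.trans (by simp)
      add_mem' := fun {s t} hs ht K => by
        filter_upwards [hs K, ht K, Lp.coeFn_add s.2 t.2] with x h1 h2 h3 hx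
        simp only [Prod.fst_add, Prod.snd_add, Pi.add_apply, map_add] at h3 ⊢
        rw [h3, h1 hx, h2 hx]
      smul_mem' := fun c s hs K => by
        filter_upwards [hs K, Lp.coeFn_smul c s.2] with x h1 h3 hx
        simp only [Prod.smul_fst, Prod.smul_snd, Pi.smul_apply, map_smul] at h3 ⊢
        rw [h3, h1 hx] }
  have hinj : Function.Injective ((LinearMap.fst ℝ _ _).comp S.subtype) := by
    rw [← LinearMap.ker_eq_bot, LinearMap.ker_eq_bot']
    rintro ⟨⟨p, v⟩, hs⟩ hp
    have hp0 : p = 0 := hp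
    subst hp0
    have hs' : ∀ K : {K : Finset Vec // IsCell 𝒯 K}, ∀ᵐ x ∂(volume.restrict D),
        x ∈ convexHull ℝ (K.1 : Set Vec) → v x = ev K 0 x := hs
    have hv : v = 0 := by
      refine Lp.ext ?_
      filter_upwards [ae_all_iff.2 hs', ae_restrict_mem hD.measurableSet,
        Lp.coeFn_zero F 2 (volume.restrict D)] with x hx hxD h0
      obtain ⟨K, hK, hxK⟩ := h.exists_cell_mem (subset_closure hxD)
      rw [hx ⟨K, hK⟩ hxK, h0]; simp
    subst hv
    rfl
  have : FiniteDimensional ℝ S := Module.Finite.of_injective _ hinj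
  have hle : V ≤ S.map (LinearMap.snd ℝ _ _) := by
    intro v hv
    choose p hp using hV v hv
    exact ⟨(p, v), hp, rfl⟩
  exact Submodule.finiteDimensional_of_le hle

end Mesh

/-! ### The discrete spaces: linear structure, finite dimension, boundedness -/

section Spaces

variable {D : Set Vec}

/-- The MINI velocity space as a subspace of `L²`. -/
def vSubmodule (D : Set Vec) (𝒯 : Geometry.SimplicialComplex ℝ Vec) :
    Submodule ℝ (LTwo D Vec) where
  carrier := VSpace D 𝒯
  zero_mem' := ⟨0, continuousOn_const, Lp.coeFn_zero _ _ _, fun _ _ => ⟨0, 0, fun x _ => by simp⟩⟩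
  add_mem' := by
    rintro u v ⟨f, hf, huf, hfK⟩ ⟨g, hg, hvg, hgK⟩
    refine ⟨f + g, hf.add hg, ?_, fun K hK => ?_⟩
    · filter_upwards [huf, hvg, Lp.coeFn_add u v] with x h1 h2 h3
      rw [h3, Pi.add_apply, h1, h2, Pi.add_apply]
    · obtain ⟨A, c, hA⟩ := hfK K hK
      obtain ⟨A', c', hA'⟩ := hgK K hK
      refine ⟨A + A', c + c', fun x hx => ?_⟩
      rw [Pi.add_apply, hA x hx, hA' x hx, AffineMap.coe_add, Pi.add_apply]
      module
  smul_mem' := by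
    rintro r u ⟨f, hf, huf, hfK⟩
    refine ⟨r • f, hf.const_smul r, ?_, fun K hK => ?_⟩
    · filter_upwards [huf, Lp.coeFn_smul r u] with x h1 h3
      rw [h3, Pi.smul_apply, h1, Pi.smul_apply]
    · obtain ⟨A, c, hA⟩ := hfK K hK
      refine ⟨r • A, r • c, fun x hx => ?_⟩
      rw [Pi.smul_apply, hA x hx, AffineMap.coe_smul, Pi.smul_apply]
      module

/-- The velocity space with zero trace as a subspace of `L²`. -/
def vZeroSubmodule (hD : IsOpen D) (𝒯 : Geometry.SimplicialComplex ℝ Vec) :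
    Submodule ℝ (LTwo D Vec) :=
  vSubmodule D 𝒯 ⊓ hOneZeroSubmodule hD

/-- The pressure space with zero average as a subspace of `L²`. -/
def qZeroSubmodule [IsFiniteMeasure (volume.restrict D)]
    (𝒯 : Geometry.SimplicialComplex ℝ Vec) : Submodule ℝ (LTwo D ℝ) where
  carrier := QZero D 𝒯
  zero_mem' := ⟨⟨0, continuousOn_const, Lp.coeFn_zero _ _ _, fun _ _ => ⟨0, fun x _ => by simp⟩⟩,
    by simpa using integral_smul_const_smul (fun _ => 1) 0 (0 : LTwo D ℝ)⟩
  add_mem' := by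
    rintro u v ⟨⟨f, hf, huf, hfK⟩, hu⟩ ⟨⟨g, hg, hvg, hgK⟩, hv⟩
    refine ⟨⟨f + g, hf.add hg, ?_, fun K hK => ?_⟩, ?_⟩
    · filter_upwards [huf, hvg, Lp.coeFn_add u v] with x h1 h2 h3
      rw [h3, Pi.add_apply, h1, h2, Pi.add_apply]
    · obtain ⟨A, hA⟩ := hfK K hK
      obtain ⟨A', hA'⟩ := hgK K hK
      refine ⟨A + A', fun x hx => ?_⟩
      rw [Pi.add_apply, hA x hx, hA' x hx, AffineMap.coe_add, Pi.add_apply]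
    · simpa [hu, hv] using integral_smul_add (memLp_const (1 : ℝ)) u v
  smul_mem' := by
    rintro r u ⟨⟨f, hf, huf, hfK⟩, hu⟩
    refine ⟨⟨r • f, hf.const_smul r, ?_, fun K hK => ?_⟩, ?_⟩
    · filter_upwards [huf, Lp.coeFn_smul r u] with x h1 h3
      rw [h3, Pi.smul_apply, h1, Pi.smul_apply]
    · obtain ⟨A, hA⟩ := hfK K hK
      refine ⟨r • A, fun x hx => ?_⟩
      rw [Pi.smul_apply, hA x hx, AffineMap.coe_smul, Pi.smul_apply]
    · simpa [hu] using integral_smul_const_smul (fun _ => 1) r u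

theorem cross_add_right (x b c : Vec) : cross x (b + c) = cross x b + cross x c := by
  simp [cross]

theorem cross_smul_right (x : Vec) (r : ℝ) (b : Vec) : cross x (r • b) = r • cross x b := by
  simp [cross]

theorem cross_add_left (x y b : Vec) : cross (x + y) b = cross x b + cross y b := by
  simp [cross]

theorem cross_smul_left (r : ℝ) (x b : Vec) : cross (r • x) b = r • cross x b := by
  simp [cross]

theorem cross_zero_right (x : Vec) : cross x 0 = 0 := by
  simp [cross]

/-- The cross product as a continuous bilinear map. -/
def crossCLM : Vec →L[ℝ] Vec →L[ℝ] Vec :=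
  (LinearMap.mk₂ ℝ cross cross_add_left cross_smul_left cross_add_right
    fun r x b => cross_smul_right x r b).toContinuousBilinearMap

/-- The Nédélec space with zero tangential trace as a subspace of `L²`. -/
def xZeroSubmodule (hD : IsOpen D) (𝒯 : Geometry.SimplicialComplex ℝ Vec) :
    Submodule ℝ (LTwo D Vec) where
  carrier := XZero D 𝒯
  zero_mem' := by
    have h := (hCurlZeroSubmodule hD).zero_mem
    refine ⟨⟨h.1, fun K hK => ⟨0, 0, ?_⟩⟩, h⟩
    filter_upwards [Lp.coeFn_zero Vec 2 (volume.restrict D)] with x hx _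
    rw [hx]; simp [cross_zero_right]
  add_mem' := by
    rintro u v ⟨⟨_, huK⟩, hu⟩ ⟨⟨_, hvK⟩, hv⟩
    have h := (hCurlZeroSubmodule hD).add_mem hu hv
    refine ⟨⟨h.1, fun K hK => ?_⟩, h⟩
    obtain ⟨a, b, hab⟩ := huK K hK
    obtain ⟨a', b', hab'⟩ := hvK K hK
    refine ⟨a + a', b + b', ?_⟩
    filter_upwards [hab, hab', Lp.coeFn_add u v] with x h1 h2 h3 hx
    rw [h3, Pi.add_apply, h1 hx, h2 hx, cross_add_right]
    module
  smul_mem' := by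
    rintro r u ⟨⟨_, huK⟩, hu⟩
    have h := (hCurlZeroSubmodule hD).smul_mem r hu
    refine ⟨⟨h.1, fun K hK => ?_⟩, h⟩
    obtain ⟨a, b, hab⟩ := huK K hK
    refine ⟨r • a, r • b, ?_⟩
    filter_upwards [hab, Lp.coeFn_smul r u] with x h1 h3 hx
    rw [h3, Pi.smul_apply, h1 hx, cross_smul_right]
    module

/-- The Raviart-Thomas space with zero normal trace as a subspace of `L²`. -/
def rtZeroSubmodule (hD : IsOpen D) (𝒯 : Geometry.SimplicialComplex ℝ Vec) :
    Submodule ℝ (LTwo D Vec) where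
  carrier := RTZero D 𝒯
  zero_mem' := by
    have h := (hDivZeroSubmodule hD).zero_mem
    refine ⟨⟨h.1, fun K hK => ⟨0, 0, ?_⟩⟩, h⟩
    filter_upwards [Lp.coeFn_zero Vec 2 (volume.restrict D)] with x hx _
    rw [hx]; simp
  add_mem' := by
    rintro u v ⟨⟨_, huK⟩, hu⟩ ⟨⟨_, hvK⟩, hv⟩
    have h := (hDivZeroSubmodule hD).add_mem hu hv
    refine ⟨⟨h.1, fun K hK => ?_⟩, h⟩
    obtain ⟨a, b, hab⟩ := huK K hK
    obtain ⟨a', b', hab'⟩ := hvK K hK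
    refine ⟨a + a', b + b', ?_⟩
    filter_upwards [hab, hab', Lp.coeFn_add u v] with x h1 h2 h3 hx
    rw [h3, Pi.add_apply, h1 hx, h2 hx]
    module
  smul_mem' := by
    rintro r u ⟨⟨_, huK⟩, hu⟩
    have h := (hDivZeroSubmodule hD).smul_mem r hu
    refine ⟨⟨h.1, fun K hK => ?_⟩, h⟩
    obtain ⟨a, b, hab⟩ := huK K hK
    refine ⟨r • a, r • b, ?_⟩
    filter_upwards [hab, Lp.coeFn_smul r u] with x h1 h3 hx
    rw [h3, Pi.smul_apply, h1 hx]
    module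

variable {𝒯 : Geometry.SimplicialComplex ℝ Vec}

theorem finiteDimensional_vZero (h : IsTriangulation D 𝒯) (hD : IsOpen D) :
    FiniteDimensional ℝ (vZeroSubmodule hD 𝒯) := by
  refine h.finiteDimensional_of_piecewise hD _ (P := (Vec →ᵃ[ℝ] Vec) × Vec)
    (fun K => { toFun := fun p x => p.1 x + bubble K.2 x • p.2
                map_add' := fun p q => by
                  funext x
                  simp only [Prod.fst_add, Prod.snd_add, AffineMap.coe_add, Pi.add_apply]
                  module
                map_smul' := fun r p => by
                  funext x
                  simp only [Prod.smul_fst, Prod.smul_snd, AffineMap.coe_smul, Pi.smul_apply,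
                    RingHom.id_apply]
                  module }) ?_
  rintro v ⟨⟨g, -, hvg, hgK⟩, -⟩ K
  obtain ⟨A, c, hA⟩ := hgK K.1 K.2
  refine ⟨(A, c), ?_⟩
  filter_upwards [hvg] with x hx hxK
  rw [hx, hA x hxK]; rfl

theorem finiteDimensional_qZero (h : IsTriangulation D 𝒯) (hD : IsOpen D)
    [IsFiniteMeasure (volume.restrict D)] :
    FiniteDimensional ℝ (qZeroSubmodule (D := D) 𝒯) := by
  refine h.finiteDimensional_of_piecewise hD _ (P := Vec →ᵃ[ℝ] ℝ)
    (fun K => { toFun := fun p x => p x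
                map_add' := fun p q => rfl
                map_smul' := fun r p => rfl }) ?_
  rintro v ⟨⟨g, -, hvg, hgK⟩, -⟩ K
  obtain ⟨A, hA⟩ := hgK K.1 K.2
  refine ⟨A, ?_⟩
  filter_upwards [hvg] with x hx hxK
  rw [hx, hA x hxK]; rfl

theorem finiteDimensional_xZero (h : IsTriangulation D 𝒯) (hD : IsOpen D) :
    FiniteDimensional ℝ (xZeroSubmodule hD 𝒯) := by
  refine h.finiteDimensional_of_piecewise hD _ (P := Vec × Vec)
    (fun K => { toFun := fun p x => p.1 + cross x p.2
                map_add' := fun p q => by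
                  funext x
                  simp only [Prod.fst_add, Prod.snd_add, cross_add_right, Pi.add_apply]
                  module
                map_smul' := fun r p => by
                  funext x
                  simp only [Prod.smul_fst, Prod.smul_snd, cross_smul_right, Pi.smul_apply,
                    RingHom.id_apply]
                  module }) ?_
  rintro v ⟨⟨-, hvK⟩, -⟩ K
  obtain ⟨a, b, hab⟩ := hvK K.1 K.2
  exact ⟨(a, b), hab⟩

theorem finiteDimensional_rtZero (h : IsTriangulation D 𝒯) (hD : IsOpen D) :
    FiniteDimensional ℝ (rtZeroSubmodule hD 𝒯) := by
  refine h.finiteDimensional_of_piecewise hD _ (P := Vec × ℝ)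
    (fun K => { toFun := fun p x => p.1 + p.2 • x
                map_add' := fun p q => by
                  funext x
                  simp only [Prod.fst_add, Prod.snd_add, Pi.add_apply]
                  module
                map_smul' := fun r p => by
                  funext x
                  simp only [Prod.smul_fst, Prod.smul_snd, Pi.smul_apply, smul_eq_mul,
                    RingHom.id_apply]
                  module }) ?_
  rintro v ⟨⟨-, hvK⟩, -⟩ K
  obtain ⟨a, b, hab⟩ := hvK K.1 K.2
  exact ⟨(a, b), hab⟩

theorem ae_bounded_of_mem_VSpace (h : IsTriangulation D 𝒯) (hD : IsOpen D) {v : LTwo D Vec}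
    (hv : v ∈ VSpace D 𝒯) : ∃ C, ∀ᵐ x ∂(volume.restrict D), ‖v x‖ ≤ C := by
  obtain ⟨g, hg, hvg, -⟩ := hv
  obtain ⟨C, hC⟩ := h.isCompact_closure.exists_bound_of_continuousOn hg
  refine ⟨C, ?_⟩
  filter_upwards [hvg, ae_restrict_mem hD.measurableSet] with x hx hxD
  rw [hx]
  exact hC x (subset_closure hxD)

theorem ae_bounded_of_mem_RTSpace (h : IsTriangulation D 𝒯) (hD : IsOpen D) {v : LTwo D Vec}
    (hv : v ∈ RTSpace D 𝒯) : ∃ C, ∀ᵐ x ∂(volume.restrict D), ‖v x‖ ≤ C := by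
  refine h.ae_bounded hD v fun K hK => ?_
  obtain ⟨a, c, hac⟩ := hv.2 K hK
  exact ⟨fun x => a + c • x, by fun_prop, hac⟩

end Spaces

end

/-! ### Bubble functions and control of the pressure -/

section

/-- The bounds by 0 and 1 are essential: a product of unbounded Lipschitz functions need not be
Lipschitz. -/
theorem exists_lipschitzWith_prod {ι : Type} (s : Finset ι) (f : ι → Vec → ℝ)
    (hf : ∀ i, ∃ C, LipschitzWith C (f i)) (h0 : ∀ i x, 0 ≤ f i x) (h1 : ∀ i x, f i x ≤ 1) :
    ∃ C, LipschitzWith C fun x => ∏ i ∈ s, f i x := by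
  classical
  induction s using Finset.induction_on with
  | empty => exact ⟨0, by simp⟩
  | insert a s ha ih =>
    obtain ⟨C, hC⟩ := hf a
    obtain ⟨C', hC'⟩ := ih
    refine ⟨C + C', LipschitzWith.of_dist_le_mul fun x y => ?_⟩
    have hx := hC.dist_le_mul x y
    have hx' := hC'.dist_le_mul x y
    simp only [Finset.prod_insert ha, Real.dist_eq, NNReal.coe_add] at hx hx' ⊢
    set p := ∏ i ∈ s, f i x
    set q := ∏ i ∈ s, f i y
    have hp0 : 0 ≤ p := Finset.prod_nonneg fun i _ => h0 i x
    have hp1 : p ≤ 1 := Finset.prod_le_one (fun i _ => h0 i x) fun i _ => h1 i x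
    calc |f a x * p - f a y * q| = |(f a x - f a y) * p + f a y * (p - q)| := by ring_nf
      _ ≤ |f a x - f a y| * |p| + |f a y| * |p - q| := by
        rw [← abs_mul, ← abs_mul]; exact abs_add_le _ _
      _ ≤ |f a x - f a y| * 1 + 1 * |p - q| := by
        rw [abs_of_nonneg hp0, abs_of_nonneg (h0 a y)]
        gcongr
        exact h1 a y
      _ ≤ (C + C') * dist x y := by linarith

variable {D : Set Vec} {𝒯 : Geometry.SimplicialComplex ℝ Vec}

section Cutoff

variable {K : Finset Vec} (hK : IsCell 𝒯 K)

theorem range_cellBasis : Set.range (cellBasis hK) = (K : Set Vec) :=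
  Subtype.range_coe

theorem mem_hull_iff {x : Vec} :
    x ∈ convexHull ℝ (K : Set Vec) ↔ ∀ v, 0 ≤ (cellBasis hK).coord v x := by
  rw [← range_cellBasis hK, (cellBasis hK).convexHull_eq_nonneg_coord]
  rfl

theorem mem_interior_hull_iff {x : Vec} :
    x ∈ interior (convexHull ℝ (K : Set Vec)) ↔ ∀ v, 0 < (cellBasis hK).coord v x := by
  rw [← range_cellBasis hK, (cellBasis hK).interior_convexHull]
  rfl

/-- The bubble function of a cell, extended by zero. -/
def bubbleExt (x : Vec) : ℝ := ∏ v : K, max 0 (min ((cellBasis hK).coord v x) 1)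

theorem bubbleExt_nonneg (x : Vec) : 0 ≤ bubbleExt hK x :=
  Finset.prod_nonneg fun _ _ => le_max_left _ _

/-- The clamp of each coordinate to [0, 1] serves this: the factors stay bounded and Lipschitz on
the whole space. -/
theorem exists_lipschitzWith_bubbleExt : ∃ C, LipschitzWith C (bubbleExt hK) := by
  refine exists_lipschitzWith_prod _ _ (fun v => ?_) (fun v x => le_max_left _ _)
    fun v x => max_le zero_le_one (min_le_right _ _)
  obtain ⟨C, hC⟩ := ((cellBasis hK).coord v).lipschitzWith_of_finiteDimensional
  exact ⟨C, (hC.min_const 1).const_max 0⟩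

theorem bubbleExt_eq_bubble {x : Vec} (hx : x ∈ convexHull ℝ (K : Set Vec)) :
    bubbleExt hK x = bubble hK x := by
  rw [mem_hull_iff hK] at hx
  refine Finset.prod_congr rfl fun v _ => ?_
  have h1 : (cellBasis hK).coord v x ≤ 1 := by
    rw [← (cellBasis hK).sum_coord_apply_eq_one x]
    exact Finset.single_le_sum (fun i _ => hx i) (Finset.mem_univ v)
  rw [min_eq_left h1, max_eq_right (hx v)]

theorem bubbleExt_eq_zero {x : Vec} {v : K} (hv : (cellBasis hK).coord v x ≤ 0) :
    bubbleExt hK x = 0 :=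
  Finset.prod_eq_zero (Finset.mem_univ v) (by
    rw [min_eq_left (hv.trans zero_le_one), max_eq_left hv])

theorem bubbleExt_eq_zero_of_notMem {x : Vec}
    (hx : x ∉ interior (convexHull ℝ (K : Set Vec))) : bubbleExt hK x = 0 := by
  rw [mem_interior_hull_iff hK] at hx
  push Not at hx
  obtain ⟨v, hv⟩ := hx
  exact bubbleExt_eq_zero hK hv

/-- By conformity the two cells meet only in the hull of their common vertices, and there the
coordinate of a vertex of `K` missing from `K'` vanishes. -/
theorem bubbleExt_eq_zero_of_ne {K' : Finset Vec} (hK' : IsCell 𝒯 K') (hne : K' ≠ K) {x : Vec}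
    (hx : x ∈ convexHull ℝ (K' : Set Vec)) : bubbleExt hK x = 0 := by
  by_cases hxK : x ∈ convexHull ℝ (K : Set Vec)
  · obtain ⟨v, hvK, hvK'⟩ : ∃ v ∈ K, v ∉ K' := by
      by_contra! h
      exact hne (Finset.eq_of_subset_of_card_le h (by rw [hK.2, hK'.2])).symm
    refine bubbleExt_eq_zero hK (v := ⟨v, hvK⟩) ?_
    have hmem := 𝒯.inter_subset_convexHull hK.1 hK'.1 ⟨hxK, hx⟩
    have hconv : Convex ℝ {y | (cellBasis hK).coord ⟨v, hvK⟩ y ≤ 0} :=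
      (convex_Iic (0 : ℝ)).affine_preimage ((cellBasis hK).coord ⟨v, hvK⟩)
    refine convexHull_min ?_ hconv hmem
    rintro w ⟨hwK, hwK'⟩
    have hwv : (⟨v, hvK⟩ : K) ≠ ⟨w, hwK⟩ := by
      rintro h
      obtain rfl : v = w := congrArg Subtype.val h
      exact hvK' hwK'
    exact ((cellBasis hK).coord_apply_ne hwv).le
  · exact bubbleExt_eq_zero_of_notMem hK fun h => hxK (interior_subset h)

theorem hasCompactSupport_bubbleExt : HasCompactSupport (bubbleExt hK) :=
  HasCompactSupport.intro (isCompact_hull K) fun _ hx =>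
    bubbleExt_eq_zero_of_notMem hK fun h => hx (interior_subset h)

theorem continuous_bubbleExt : Continuous (bubbleExt hK) :=
  (exists_lipschitzWith_bubbleExt hK).choose_spec.continuous

theorem integral_bubbleExt_pos : 0 < ∫ x, bubbleExt hK x := by
  have hne : (interior (convexHull ℝ (K : Set Vec))).Nonempty := by
    rw [← range_cellBasis hK]
    exact interior_convexHull_nonempty_iff_affineSpan_eq_top.2 (cellBasis hK).tot
  obtain ⟨x, hx⟩ := hne
  rw [mem_interior_hull_iff hK] at hx
  refine (continuous_bubbleExt hK).integral_pos_of_hasCompactSupport_nonneg_nonzero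
    (hasCompactSupport_bubbleExt hK) (bubbleExt_nonneg hK) (x := x) ?_
  exact Finset.prod_ne_zero_iff.2 fun v _ =>
    (lt_max_of_lt_right (lt_min (hx v) one_pos)).ne'

/-- Such points are minima of a nonnegative function. Faces are included: where the extension has a
kink and no derivative, `lineDeriv` takes its default value 0. -/
theorem lineDeriv_bubbleExt_eq_zero {x : Vec}
    (hx : x ∉ interior (convexHull ℝ (K : Set Vec))) (v : Vec) :
    lineDeriv ℝ (bubbleExt hK) x v = 0 := by
  have hmin : IsLocalMin (bubbleExt hK) x := Filter.Eventually.of_forall fun y => by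
    rw [bubbleExt_eq_zero_of_notMem hK hx]; exact bubbleExt_nonneg hK y
  rw [hmin.lineDeriv_eq_zero]; rfl

/-- Integration by parts against the extended bubble, over a set that contains the interior of the
cell. -/
theorem setIntegral_lineDeriv_bubbleExt (hKD : interior (convexHull ℝ (K : Set Vec)) ⊆ D)
    {f : Vec → ℝ} {C : NNReal} (hf : LipschitzWith C f) (v : Vec) :
    ∫ x in D, f x * lineDeriv ℝ (bubbleExt hK) x v
      = - ∫ x in D, lineDeriv ℝ f x v * bubbleExt hK x := by
  obtain ⟨C', hC'⟩ := exists_lipschitzWith_bubbleExt hK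
  -- Both integrands vanish off `D`, so the integrals extend to the whole space, where integration
  -- by parts for Lipschitz functions applies. It yields the direction `-v`, whence the sign.
  rw [setIntegral_eq_integral_of_forall_compl_eq_zero,
    setIntegral_eq_integral_of_forall_compl_eq_zero,
    hf.integral_lineDeriv_mul_eq hC' (hasCompactSupport_bubbleExt hK) v, ← integral_neg]
  · refine integral_congr_ae (.of_forall fun x => ?_)
    simp only [lineDeriv_neg]
    ring
  · intro x hx
    rw [bubbleExt_eq_zero_of_notMem hK fun h => hx (hKD h), mul_zero]
  · intro x hx
    rw [lineDeriv_bubbleExt_eq_zero hK fun h => hx (hKD h), mul_zero]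

theorem setIntegral_mul_lineDeriv_bubbleExt (hKD : interior (convexHull ℝ (K : Set Vec)) ⊆ D)
    {φ : Vec → ℝ} (hφ : IsSmoothCompact φ) (i : Fin 3) :
    ∫ x in D, φ x * lineDeriv ℝ (bubbleExt hK) x (basisVec i)
      = - ∫ x in D, partialAt i φ x * bubbleExt hK x := by
  obtain ⟨C, hC⟩ := hφ.1.lipschitzWith_of_hasCompactSupport hφ.2 (by simp)
  rw [setIntegral_lineDeriv_bubbleExt hK hKD hC]
  have h : ∀ x, lineDeriv ℝ φ x (basisVec i) = partialAt i φ x := fun x =>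
    (hφ.differentiable x).lineDeriv_eq_fderiv
  simp only [h]

end Cutoff

/-- The image of `D` is connected and finite, hence a single value; the zero mean makes that value
0. -/
theorem eq_zero_of_piecewise_constant (h : IsTriangulation D 𝒯) (hD : IsOpen D)
    (hconn : IsConnected D) {p : LTwo D ℝ} {g : Vec → ℝ} (hg : ContinuousOn g (closure D))
    (hpg : ∀ᵐ x ∂(volume.restrict D), p x = g x)
    (hK : ∀ K, IsCell 𝒯 K → ∃ c, ∀ x ∈ convexHull ℝ (K : Set Vec), g x = c)
    (hmean : ∫ x in D, p x = 0) : p = 0 := by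
  have := h.finite_cells
  have := h.isFiniteMeasure
  choose c hc using fun K : {K : Finset Vec // IsCell 𝒯 K} => hK K.1 K.2
  have hfin : (g '' D).Finite := by
    refine (Set.finite_range c).subset ?_
    rintro _ ⟨x, hx, rfl⟩
    obtain ⟨K, hK, hxK⟩ := h.exists_cell_mem (subset_closure hx)
    exact ⟨⟨K, hK⟩, (hc ⟨K, hK⟩ x hxK).symm⟩
  have hsub : (g '' D).Subsingleton := by
    rw [← Set.not_nontrivial_iff]
    intro hnt
    exact (hconn.isPreconnected.image g (hg.mono subset_closure)).infinite_of_nontrivial hnt hfin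
  obtain ⟨x₀, hx₀⟩ := hconn.nonempty
  have hconst : ∀ᵐ x ∂(volume.restrict D), p x = g x₀ := by
    filter_upwards [hpg, ae_restrict_mem hD.measurableSet] with x hx hxD
    rw [hx]
    exact hsub ⟨x, hxD, rfl⟩ ⟨x₀, hx₀, rfl⟩
  rw [integral_congr_ae hconst, integral_const] at hmean
  have hvol : (volume.restrict D).real Set.univ ≠ 0 := by
    rw [measureReal_ne_zero_iff, Measure.restrict_apply_univ]
    exact (hD.measure_pos volume hconn.nonempty).ne'
  have h0 : g x₀ = 0 := (mul_eq_zero.1 hmean).resolve_left hvol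
  refine Lp.ext ?_
  filter_upwards [hconst, Lp.coeFn_zero ℝ 2 (volume.restrict D)] with x hx hx0
  rw [hx, hx0, h0]; rfl

theorem memLp_bubbleExt_smul {K : Finset Vec} (hK : IsCell 𝒯 K) (c : Vec) :
    MemLp (fun x => bubbleExt hK x • c) 2 (volume.restrict D) :=
  ((continuous_bubbleExt hK).smul continuous_const).memLp_of_hasCompactSupport
    (hasCompactSupport_bubbleExt hK).smul_right

variable [IsFiniteMeasure (volume.restrict D)] {K : Finset Vec} (hK : IsCell 𝒯 K)

theorem memLp_lineDeriv_bubbleExt (v : Vec) :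
    MemLp (fun x => lineDeriv ℝ (bubbleExt hK) x v) 2 (volume.restrict D) := by
  obtain ⟨C, hC⟩ := exists_lipschitzWith_bubbleExt hK
  exact (hC.memLp_lineDeriv v).mono_exponent le_top

/-- The bubble field `b_K c` of a cell as an element of `L²`. -/
def bubbleField (D : Set Vec) [IsFiniteMeasure (volume.restrict D)] (c : Vec) : LTwo D Vec :=
  (memLp_bubbleExt_smul hK c).toLp _

theorem coeFn_bubbleField (c : Vec) :
    ∀ᵐ x ∂(volume.restrict D), bubbleField hK D c x = bubbleExt hK x • c :=
  (memLp_bubbleExt_smul hK c).coeFn_toLp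

theorem bubbleField_mem_VSpace (c : Vec) : bubbleField hK D c ∈ VSpace D 𝒯 := by
  refine ⟨fun x => bubbleExt hK x • c,
    ((continuous_bubbleExt hK).smul continuous_const).continuousOn, coeFn_bubbleField hK c,
    fun K' hK' => ?_⟩
  by_cases hne : K' = K
  · subst hne
    exact ⟨0, c, fun x hx => by simp [bubbleExt_eq_bubble hK hx]⟩
  · exact ⟨0, 0, fun x hx => by simp [bubbleExt_eq_zero_of_ne hK hK' hne hx]⟩

/-- The bubble vanishes outside the cell interior, so Green's formula has no boundary term for any
smooth φ, whether or not φ is supported in `D`. -/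
theorem bubbleField_mem_HOneZero (hD : IsOpen D)
    (hKD : interior (convexHull ℝ (K : Set Vec)) ⊆ D) (c : Vec) :
    bubbleField hK D c ∈ HOneZero D := by
  refine (mem_HOneZero_iff hD).2 fun i => ?_
  have hm : MemLp (fun x => lineDeriv ℝ (bubbleExt hK) x (basisVec i) • c) 2
      (volume.restrict D) :=
    (memLp_const (p := ⊤) c).smul (memLp_lineDeriv_bubbleExt hK (basisVec i))
  refine ⟨hm.toLp _, fun φ hφ => ?_⟩
  have h1 : ∫ x in D, φ x • hm.toLp _ x
      = (∫ x in D, φ x * lineDeriv ℝ (bubbleExt hK) x (basisVec i)) • c := by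
    rw [← integral_smul_const]
    refine integral_congr_ae ?_
    filter_upwards [hm.coeFn_toLp] with x hx
    rw [hx, smul_smul]
  have h2 : ∫ x in D, partialAt i φ x • bubbleField hK D c x
      = (∫ x in D, partialAt i φ x * bubbleExt hK x) • c := by
    rw [← integral_smul_const]
    refine integral_congr_ae ?_
    filter_upwards [coeFn_bubbleField hK c] with x hx
    rw [hx, smul_smul]
  rw [h1, h2, setIntegral_mul_lineDeriv_bubbleExt hK hKD hφ, neg_smul]

theorem weakDiv_bubbleField (hD : IsOpen D)
    (hKD : interior (convexHull ℝ (K : Set Vec)) ⊆ D) (i : Fin 3) :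
    ∀ᵐ x ∂(volume.restrict D), weakDiv D (bubbleField hK D (basisVec i)) x
      = lineDeriv ℝ (bubbleExt hK) x (basisVec i) := by
  have hm := memLp_lineDeriv_bubbleExt (D := D) hK (basisVec i)
  have h : weakDiv D (bubbleField hK D (basisVec i)) = hm.toLp _ := by
    refine weakDiv_eq hD fun φ hφ => ?_
    have h1 : ∫ x in D, hm.toLp _ x * φ x
        = ∫ x in D, φ x * lineDeriv ℝ (bubbleExt hK) x (basisVec i) := by
      refine integral_congr_ae ?_
      filter_upwards [hm.coeFn_toLp] with x hx
      rw [hx, mul_comm]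
    have h2 : ∫ x in D, inner ℝ (bubbleField hK D (basisVec i) x) (gradAt φ x)
        = ∫ x in D, partialAt i φ x * bubbleExt hK x := by
      refine integral_congr_ae ?_
      filter_upwards [coeFn_bubbleField hK (basisVec i)] with x hx
      rw [hx, real_inner_smul_left, basisVec, EuclideanSpace.inner_single_left]
      simp [gradAt, mul_comm]
    rw [h1, h2, setIntegral_mul_lineDeriv_bubbleExt hK hKD hφ.1]
  rw [h]
  exact hm.coeFn_toLp

/-- The bubbles control the pressure: a pressure orthogonal to the divergence of the velocity space
has zero gradient on every cell. -/
theorem linear_eq_zero_of_orthogonal_weakDiv (hD : IsOpen D)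
    (hKD : interior (convexHull ℝ (K : Set Vec)) ⊆ D) {p : LTwo D ℝ} {A : Vec →ᵃ[ℝ] ℝ}
    (hp : ∀ᵐ x ∂(volume.restrict D), x ∈ convexHull ℝ (K : Set Vec) → p x = A x)
    (horth : ∀ i, inner ℝ p (weakDiv D (bubbleField hK D (basisVec i))) = 0) :
    A.linear = 0 := by
  obtain ⟨C, hC⟩ := A.lipschitzWith_of_finiteDimensional
  have hA : ∀ x v, lineDeriv ℝ A x v = A.linear v := by
    intro x v
    have hl : (fun t : ℝ => A (x + t • v)) = fun t => t * A.linear v + A x := by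
      funext t
      rw [add_comm x, ← vadd_eq_add, A.map_vadd]; simp
    have : HasDerivAt (fun t : ℝ => A (x + t • v)) (A.linear v) 0 := by
      rw [hl]
      simpa using ((hasDerivAt_id (0 : ℝ)).mul_const (A.linear v)).add_const (A x)
    exact this.deriv
  have hbasis : ∀ i, A.linear (basisVec i) = 0 := by
    intro i
    -- `p` may be replaced by `A` on all of `D`, since the derivative of the bubble vanishes where
    -- they may differ.
    have h1 : inner ℝ p (weakDiv D (bubbleField hK D (basisVec i)))
        = ∫ x in D, A x * lineDeriv ℝ (bubbleExt hK) x (basisVec i) := by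
      rw [L2.inner_def]
      refine integral_congr_ae ?_
      filter_upwards [hp, weakDiv_bubbleField hK hD hKD i] with x hx hx'
      rw [hx', show ∀ a b : ℝ, inner ℝ a b = a * b from fun a b => by simp [mul_comm]]
      by_cases hxK : x ∈ interior (convexHull ℝ (K : Set Vec))
      · rw [hx (interior_subset hxK)]
      · rw [lineDeriv_bubbleExt_eq_zero hK hxK, mul_zero, mul_zero]
    -- Integration by parts leaves 0 = −∂ᵢA ∫ b_K, and the integral is positive.
    rw [horth i, setIntegral_lineDeriv_bubbleExt hK hKD hC] at h1
    simp only [hA] at h1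
    rw [integral_const_mul, setIntegral_eq_integral_of_forall_compl_eq_zero fun x hx =>
      bubbleExt_eq_zero_of_notMem hK fun h => hx (hKD h)] at h1
    simpa [(integral_bubbleExt_pos hK).ne'] using h1
  refine ((EuclideanSpace.basisFun (Fin 3) ℝ).toBasis).ext fun i => ?_
  simpa [basisVec] using hbasis i

/-- The qualitative inf-sup condition of the MINI element: unique solvability on a fixed mesh needs
injectivity only, not a constant. -/
theorem eq_zero_of_orthogonal_weakDiv (h : IsTriangulation D 𝒯) (hD : IsOpen D)
    (hreg : interior (closure D) = D) (hconn : IsConnected D) {p : LTwo D ℝ}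
    (hp : p ∈ QZero D 𝒯) (horth : ∀ φ ∈ VZero D 𝒯, inner ℝ p (weakDiv D φ) = 0) : p = 0 := by
  obtain ⟨⟨g, hg, hpg, hgK⟩, hmean⟩ := hp
  refine eq_zero_of_piecewise_constant h hD hconn hg hpg (fun K hK => ?_) hmean
  obtain ⟨A, hA⟩ := hgK K hK
  have hKD := h.interior_hull_subset hreg hK
  have hlin : A.linear = 0 := linear_eq_zero_of_orthogonal_weakDiv hK hD hKD
    (by filter_upwards [hpg] with x hx hxK; rw [hx, hA x hxK])
    fun i => horth _ ⟨bubbleField_mem_VSpace hK _, bubbleField_mem_HOneZero hK hD hKD _⟩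
  obtain ⟨q, rfl⟩ := A.linear_eq_zero_iff_exists_const.1 hlin
  exact ⟨q, fun x hx => by rw [hA x hx]; rfl⟩

end

/-! ### The curl of a Nédélec field is a Raviart–Thomas field -/

section

variable {D : Set Vec} {𝒯 : Geometry.SimplicialComplex ℝ Vec}

theorem integral_add_add {f g h : Vec → ℝ} (hf : Integrable f) (hg : Integrable g)
    (hh : Integrable h) :
    ∫ x, (f x + g x + h x) = (∫ x, f x) + (∫ x, g x) + ∫ x, h x := by
  rw [integral_add (f := fun x => f x + g x) (hf.add hg) hh, integral_add hf hg]

/-- The fields `a + x × b` have the constant curl `-2 b`. -/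
theorem integral_inner_curlAt (a b : Vec) {φ : Vec → Vec} (hφ : IsSmoothCompact φ) :
    ∫ x, inner ℝ (a + cross x b) (curlAt φ x) = ∫ x, inner ℝ ((-2 : ℝ) • b) (φ x) := by
  have hf : ∀ k, ContDiff ℝ 1 fun x : Vec => (a + cross x b) k := fun k =>
    contDiff_euclidean.1 (contDiff_const.add (crossCLM.flip b).contDiff) k
  have hd : ∀ i k x, partialAt i (fun y : Vec => (a + cross y b) k) x
      = cross (basisVec i) b k := by
    intro i k x
    have h : HasFDerivAt (fun y : Vec => (a + cross y b) k)
        ((coordCLM k).comp (crossCLM.flip b)) x :=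
      (coordCLM k).hasFDerivAt.comp x (((crossCLM.flip b).hasFDerivAt).const_add a)
    rw [partialAt, h.fderiv]; rfl
  have hparts : ∀ i j k, ∫ x, (a + cross x b) k * partialAt i φ x j
      = - ∫ x, cross (basisVec i) b k * φ x j := by
    intro i j k
    have := integral_mul_partialAt (hf k) (hφ.coord j) i
    simp only [hd] at this
    rw [← this]
    refine integral_congr_ae (.of_forall fun x => ?_)
    simp only [partialAt_coord (hφ.differentiable x)]
  have hint : ∀ i j k, Integrable fun x => (a + cross x b) k * partialAt i φ x j := fun i j k =>
    ((hf k).continuous.mul ((hφ.partialAt i).coord j).1.continuous).integrable_of_hasCompactSupport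
      ((hφ.partialAt i).coord j).2.mul_left
  have hint' : ∀ (c : ℝ) (j), Integrable fun x => c * φ x j := fun c j =>
    ((hφ.coord j).1.continuous.integrable_of_hasCompactSupport (hφ.coord j).2).const_mul c
  have hL : ∀ x, inner ℝ (a + cross x b) (curlAt φ x)
      = ((a + cross x b) 0 * partialAt 1 φ x 2 - (a + cross x b) 0 * partialAt 2 φ x 1)
      + ((a + cross x b) 1 * partialAt 2 φ x 0 - (a + cross x b) 1 * partialAt 0 φ x 2)
      + ((a + cross x b) 2 * partialAt 0 φ x 1 - (a + cross x b) 2 * partialAt 1 φ x 0) := by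
    intro x
    simp only [PiLp.inner_apply, Fin.sum_univ_three, curlAt]
    simp
    ring
  simp only [hL]
  have hsub : ∀ i j i' j' k, Integrable fun x =>
      (a + cross x b) k * partialAt i φ x j - (a + cross x b) k * partialAt i' φ x j' :=
    fun i j i' j' k => (hint i j k).sub (hint i' j' k)
  rw [integral_add_add (hsub 1 2 2 1 0) (hsub 2 0 0 2 1) (hsub 0 1 1 0 2),
    integral_sub (hint _ _ _) (hint _ _ _), integral_sub (hint _ _ _) (hint _ _ _),
    integral_sub (hint _ _ _) (hint _ _ _)]
  simp only [hparts, integral_const_mul]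
  have hR : ∀ x, inner ℝ ((-2 : ℝ) • b) (φ x)
      = (-2 * b 0) * φ x 0 + (-2 * b 1) * φ x 1 + (-2 * b 2) * φ x 2 := by
    intro x
    simp only [PiLp.inner_apply, Fin.sum_univ_three]
    simp
    ring
  simp only [hR]
  rw [integral_add_add (hint' (-2 * b 0) 0) (hint' (-2 * b 1) 1) (hint' (-2 * b 2) 2)]
  simp only [integral_const_mul]
  simp [cross, basisVec, crossProduct]
  ring

/-- The curl of a Nédélec field is constant on every cell. -/
theorem weakCurl_ae_eq_const (h : IsTriangulation D 𝒯) (hreg : interior (closure D) = D)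
    {v : LTwo D Vec} (hv : v ∈ XSpace D 𝒯) {K : Finset Vec} (hK : IsCell 𝒯 K) :
    ∃ c : Vec, ∀ᵐ x ∂(volume.restrict D), x ∈ convexHull ℝ (K : Set Vec) →
      weakCurl D v x = c := by
  have := h.isFiniteMeasure
  obtain ⟨a, b, hab⟩ := hv.2 K hK
  set U := interior (convexHull ℝ (K : Set Vec)) with hU
  have hUD : U ⊆ D := h.interior_hull_subset hreg hK
  refine ⟨(-2 : ℝ) • b, ?_⟩
  have hm : MemLp (fun _ : Vec => (-2 : ℝ) • b) 2 (volume.restrict D) := memLp_const _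
  -- Test fields supported inside the cell see only the polynomial a + x × b, whose curl is −2b; the
  -- difference of the two curls therefore vanishes there.
  have h0 := ae_eq_zero_of_vector_test (D := D) (weakCurl D v + (-1 : ℝ) • hm.toLp _)
    (isOpen_interior (s := convexHull ℝ (K : Set Vec))) fun φ hφ => by
      have hφD : IsTest D φ := ⟨hφ.1, hφ.2.trans hUD⟩
      rw [integral_inner_add (hφ.1.memLp D), integral_inner_const_smul,
        isWeakCurl_weakCurl hv.1 φ hφD]
      have h1 : ∫ x in D, inner ℝ (v x) (curlAt φ x)
          = ∫ x, inner ℝ (a + cross x b) (curlAt φ x) := by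
        refine Eq.trans ?_ (setIntegral_eq_integral_of_forall_compl_eq_zero (s := D) fun x hx => by
          rw [curlAt_eq_zero fun hxs => hx (hφD.2 hxs), inner_zero_right])
        refine integral_congr_ae ?_
        filter_upwards [hab] with x hx
        by_cases hxs : x ∈ tsupport φ
        · rw [hx (interior_subset (hφ.2 hxs))]
        · rw [curlAt_eq_zero hxs, inner_zero_right, inner_zero_right]
      have h2 : ∫ x in D, inner ℝ (hm.toLp _ x) (φ x)
          = ∫ x, inner ℝ ((-2 : ℝ) • b) (φ x) := by
        refine Eq.trans ?_ (setIntegral_eq_integral_of_forall_compl_eq_zero (s := D) fun x hx => by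
          rw [image_eq_zero_of_notMem_tsupport fun hxs => hx (hφD.2 hxs), inner_zero_right])
        refine integral_congr_ae ?_
        filter_upwards [hm.coeFn_toLp] with x hx
        rw [hx]
      rw [h1, h2, integral_inner_curlAt a b hφ.1]
      ring
  filter_upwards [h0, ae_mem_interior_hull D K, hm.coeFn_toLp,
    Lp.coeFn_add (weakCurl D v) ((-1 : ℝ) • hm.toLp _), Lp.coeFn_smul (-1 : ℝ) (hm.toLp _)]
    with x h1 h2 h3 h4 h5 hxK
  have h6 := h1 (h2 hxK)
  rw [h4, Pi.add_apply, h5, Pi.smul_apply, h3, neg_one_smul] at h6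
  exact add_neg_eq_zero.1 h6

/-- The curl maps the Nédélec space into the Raviart-Thomas space. -/
theorem weakCurl_mem_RTZero (h : IsTriangulation D 𝒯) (hD : IsOpen D)
    (hreg : interior (closure D) = D) {v : LTwo D Vec} (hv : v ∈ XZero D 𝒯) :
    weakCurl D v ∈ RTZero D 𝒯 := by
  have hz := weakCurl_mem_HDivZero hD hv.2
  refine ⟨⟨hz.1, fun K hK => ?_⟩, hz⟩
  obtain ⟨c, hc⟩ := weakCurl_ae_eq_const h hreg hv.1 hK
  refine ⟨c, 0, ?_⟩
  filter_upwards [hc] with x hx hxK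
  rw [hx hxK]; simp

end

section

/-! ### The abstract linear system -/

section Abstract

variable {H H₀ : Type} [NormedAddCommGroup H] [InnerProductSpace ℝ H] [NormedAddCommGroup H₀]
  [InnerProductSpace ℝ H₀] (V R X : Submodule ℝ H) (Q : Submodule ℝ H₀)

/-- The momentum residual as a bilinear form in the unknowns and the test field. -/
def momentumForm (G : V →ₗ[ℝ] V →ₗ[ℝ] ℝ) (C : V →ₗ[ℝ] H) (d : V →ₗ[ℝ] H₀) (S : H →ₗ[ℝ] H)
    (α₁ ν τ : ℝ) : V × Q × R × X × X →ₗ[ℝ] V →ₗ[ℝ] ℝ :=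
  LinearMap.mk₂ ℝ (fun s φ => τ⁻¹ * inner ℝ (s.1 : H) φ + α₁ * (τ⁻¹ * G s.1 φ) + ν * G s.1 φ
      + 1 / 2 * (inner ℝ (C s.1) (φ : H) - inner ℝ (C φ) (s.1 : H))
      - inner ℝ (s.2.1 : H₀) (d φ) - inner ℝ (S s.2.2.2.2) (φ : H))
    (fun s t φ => by simp [inner_add_left, inner_add_right]; ring)
    (fun c s φ => by simp [real_inner_smul_left, real_inner_smul_right]; ring)
    (fun s φ φ' => by simp [inner_add_left, inner_add_right]; ring)
    (fun c s φ => by simp [real_inner_smul_left, real_inner_smul_right]; ring)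

/-- The induction residual as a bilinear form in the unknowns and the test field. -/
def inductionForm (c : X →ₗ[ℝ] H) (τ : ℝ) : V × Q × R × X × X →ₗ[ℝ] R →ₗ[ℝ] ℝ :=
  LinearMap.mk₂ ℝ (fun s ψ => τ⁻¹ * inner ℝ (s.2.2.1 : H) ψ + inner ℝ (c s.2.2.2.1) (ψ : H))
    (fun s t φ => by simp [inner_add_left]; ring)
    (fun c s φ => by simp [real_inner_smul_left]; ring)
    (fun s φ φ' => by simp [inner_add_right]; ring)
    (fun c s φ => by simp [real_inner_smul_right]; ring)

/-- The residual of Ohm's law as a bilinear form in the unknowns and the test field. -/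
def ohmForm (S : H →ₗ[ℝ] H) (α₂ σ η τ : ℝ) : V × Q × R × X × X →ₗ[ℝ] X →ₗ[ℝ] ℝ :=
  LinearMap.mk₂ ℝ (fun s χ => α₂ * (τ⁻¹ * inner ℝ (s.2.2.2.2 : H) χ)
      + σ * inner ℝ (s.2.2.2.2 : H) χ + η * inner ℝ (S s.2.2.2.2) (χ : H)
      - inner ℝ (s.2.2.2.1 : H) χ - inner ℝ (S s.1) (χ : H))
    (fun s t φ => by simp [inner_add_left]; ring)
    (fun c s φ => by simp [real_inner_smul_left]; ring)
    (fun s φ φ' => by simp [inner_add_right]; ring)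
    (fun c s φ => by simp [real_inner_smul_right]; ring)

/-- The residual of Ampère's law as a bilinear form in the unknowns and the test field. -/
def ampereForm (c : X →ₗ[ℝ] H) : V × Q × R × X × X →ₗ[ℝ] X →ₗ[ℝ] ℝ :=
  LinearMap.mk₂ ℝ (fun s ξ => inner ℝ (s.2.2.2.2 : H) ξ - inner ℝ (s.2.2.1 : H) (c ξ))
    (fun s t φ => by simp [inner_add_left]; ring)
    (fun c s φ => by simp [real_inner_smul_left]; ring)
    (fun s φ φ' => by simp [inner_add_right]; ring)
    (fun c s φ => by simp [real_inner_smul_right]; ring)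

/-- The divergence constraint as a bilinear form in the unknowns and the test function. -/
def divForm (d : V →ₗ[ℝ] H₀) : V × Q × R × X × X →ₗ[ℝ] Q →ₗ[ℝ] ℝ :=
  LinearMap.mk₂ ℝ (fun s q => inner ℝ (d s.1) (q : H₀))
    (fun s t φ => by simp [inner_add_left])
    (fun c s φ => by simp [real_inner_smul_left])
    (fun s φ φ' => by simp [inner_add_right])
    (fun c s φ => by simp [real_inner_smul_right])

variable {V R X Q}

/-- The homogeneous system has only the zero solution. -/
theorem eq_zero_of_homogeneous {G : V →ₗ[ℝ] V →ₗ[ℝ] ℝ} (hG : ∀ u, 0 ≤ G u u) {C : V →ₗ[ℝ] H}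
    {d : V →ₗ[ℝ] H₀} {c : X →ₗ[ℝ] H} {S : H →ₗ[ℝ] H}
    (hS : ∀ a b, inner ℝ (S a) b = - inner ℝ (S b) a)
    (hd : ∀ p : Q, (∀ φ : V, inner ℝ (p : H₀) (d φ) = 0) → p = 0)
    {α₁ α₂ ν σ η τ : ℝ} (hα₁ : 0 ≤ α₁) (hα₂ : 0 ≤ α₂) (hν : 0 < ν) (hσ : 0 ≤ σ) (hτ : 0 < τ)
    {s : V × Q × R × X × X} (h1 : momentumForm V R X Q G C d S α₁ ν τ s = 0)
    (h2 : inductionForm V R X Q c τ s = 0) (h3 : ohmForm V R X Q S α₂ σ η τ s = 0)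
    (h4 : ampereForm V R X Q c s = 0) (h5 : divForm V R X Q d s = 0) : s = 0 := by
  obtain ⟨u, p, B, E, J⟩ := s
  have e1 : ∀ φ : V, τ⁻¹ * inner ℝ (u : H) φ + α₁ * (τ⁻¹ * G u φ) + ν * G u φ
      + 1 / 2 * (inner ℝ (C u) (φ : H) - inner ℝ (C φ) (u : H))
      - inner ℝ (p : H₀) (d φ) - inner ℝ (S J) (φ : H) = 0 := fun φ => DFunLike.congr_fun h1 φ
  have e2 : ∀ ψ : R, τ⁻¹ * inner ℝ (B : H) ψ + inner ℝ (c E) (ψ : H) = 0 :=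
    fun ψ => DFunLike.congr_fun h2 ψ
  have e3 : ∀ χ : X, α₂ * (τ⁻¹ * inner ℝ (J : H) χ) + σ * inner ℝ (J : H) χ
      + η * inner ℝ (S J) (χ : H) - inner ℝ (E : H) χ - inner ℝ (S u) (χ : H) = 0 :=
    fun χ => DFunLike.congr_fun h3 χ
  have e4 : ∀ ξ : X, inner ℝ (J : H) ξ - inner ℝ (B : H) (c ξ) = 0 :=
    fun ξ => DFunLike.congr_fun h4 ξ
  have e5 : ∀ q : Q, inner ℝ (d u) (q : H₀) = 0 := fun q => DFunLike.congr_fun h5 q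
  have hτ' : 0 < τ⁻¹ := inv_pos.2 hτ
  have hSJ : inner ℝ (S J) (J : H) = 0 := by linarith [hS J J]
  have hpu : inner ℝ (p : H₀) (d u) = 0 := by rw [real_inner_comm]; exact e5 p
  have hEB : inner ℝ (c E) (B : H) = inner ℝ (B : H) (c E) := real_inner_comm _ _
  have hEJ : inner ℝ (J : H) E = inner ℝ (E : H) (J : H) := real_inner_comm _ _
  have hu0 : 0 ≤ inner ℝ (u : H) (u : H) := real_inner_self_nonneg
  have hB0 : 0 ≤ inner ℝ (B : H) (B : H) := real_inner_self_nonneg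
  have hJ0 : 0 ≤ inner ℝ (J : H) (J : H) := real_inner_self_nonneg
  -- The energy identity: the sum of the equations tested with u, B, J and E. Antisymmetry of `S`
  -- cancels the Lorentz force against u × B.
  have hsum : τ⁻¹ * inner ℝ (u : H) u + τ⁻¹ * inner ℝ (B : H) B
      + (α₁ * (τ⁻¹ * G u u) + ν * G u u + α₂ * (τ⁻¹ * inner ℝ (J : H) J)
        + σ * inner ℝ (J : H) J) = 0 := by
    have := e1 u
    have := e2 B
    have := e3 J
    have := e4 E
    have := hS J u
    rw [hSJ] at *
    linarith
  have hrest : 0 ≤ α₁ * (τ⁻¹ * G u u) + ν * G u u + α₂ * (τ⁻¹ * inner ℝ (J : H) J)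
        + σ * inner ℝ (J : H) J := by
    have := hG u
    positivity
  have hu1 : 0 ≤ τ⁻¹ * inner ℝ (u : H) u := by positivity
  have hB1 : 0 ≤ τ⁻¹ * inner ℝ (B : H) B := by positivity
  have hu : u = 0 := by
    have : inner ℝ (u : H) u = 0 :=
      (mul_eq_zero.1 (by linarith : τ⁻¹ * inner ℝ (u : H) u = 0)).resolve_left hτ'.ne'
    exact Subtype.ext (inner_self_eq_zero.1 this)
  have hB : B = 0 := by
    have : inner ℝ (B : H) B = 0 :=
      (mul_eq_zero.1 (by linarith : τ⁻¹ * inner ℝ (B : H) B = 0)).resolve_left hτ'.ne'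
    exact Subtype.ext (inner_self_eq_zero.1 this)
  subst hu hB
  -- The energy does not control J when α₂ = σ = 0; Ampère's law with B = 0, tested with J, does.
  have hJ : J = 0 := by
    have := e4 J
    simp only [ZeroMemClass.coe_zero, inner_zero_left, sub_zero] at this
    exact Subtype.ext (inner_self_eq_zero.1 this)
  subst hJ
  have hE : E = 0 := by
    have := e3 E
    simp only [ZeroMemClass.coe_zero, map_zero, inner_zero_left, mul_zero, zero_sub, add_zero,
      sub_zero, neg_eq_zero] at this
    exact Subtype.ext (inner_self_eq_zero.1 this)
  subst hE
  have hp : p = 0 := hd p fun φ => by simpa using e1 φ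
  subst hp
  rfl

/-- The residual map `T` goes from the product of the spaces to the product of their duals, up to
order. The dimensions agree, so injectivity gives bijectivity. -/
theorem existsUnique_solution [FiniteDimensional ℝ V] [FiniteDimensional ℝ R]
    [FiniteDimensional ℝ X] [FiniteDimensional ℝ Q]
    {G : V →ₗ[ℝ] V →ₗ[ℝ] ℝ} (hG : ∀ u, 0 ≤ G u u) (C : V →ₗ[ℝ] H)
    {d : V →ₗ[ℝ] H₀} (c : X →ₗ[ℝ] H) {S : H →ₗ[ℝ] H}
    (hS : ∀ a b, inner ℝ (S a) b = - inner ℝ (S b) a)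
    (hd : ∀ p : Q, (∀ φ : V, inner ℝ (p : H₀) (d φ) = 0) → p = 0)
    {α₁ α₂ ν σ τ : ℝ} (η : ℝ) (hα₁ : 0 ≤ α₁) (hα₂ : 0 ≤ α₂) (hν : 0 < ν) (hσ : 0 ≤ σ)
    (hτ : 0 < τ) (u₀ : V) (B₀ : R) (J₀ : X) :
    ∃! s : V × Q × R × X × X,
      (∀ φ : V, τ⁻¹ * inner ℝ ((s.1 - u₀ : V) : H) φ + α₁ * (τ⁻¹ * G (s.1 - u₀) φ) + ν * G s.1 φ
        + 1 / 2 * (inner ℝ (C s.1) (φ : H) - inner ℝ (C φ) (s.1 : H))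
        - inner ℝ (s.2.1 : H₀) (d φ) - inner ℝ (S s.2.2.2.2) (φ : H) = 0) ∧
      (∀ ψ : R, τ⁻¹ * inner ℝ ((s.2.2.1 - B₀ : R) : H) ψ + inner ℝ (c s.2.2.2.1) (ψ : H) = 0) ∧
      (∀ χ : X, α₂ * (τ⁻¹ * inner ℝ ((s.2.2.2.2 - J₀ : X) : H) χ)
        + σ * inner ℝ (s.2.2.2.2 : H) χ + η * inner ℝ (S s.2.2.2.2) (χ : H)
        = inner ℝ (s.2.2.2.1 : H) χ + inner ℝ (S s.1) (χ : H)) ∧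
      (∀ ξ : X, inner ℝ (s.2.2.2.2 : H) ξ - inner ℝ (s.2.2.1 : H) (c ξ) = 0) ∧
      (∀ q : Q, inner ℝ (d s.1) (q : H₀) = 0) := by
  let T : V × Q × R × X × X →ₗ[ℝ]
      (V →ₗ[ℝ] ℝ) × (R →ₗ[ℝ] ℝ) × (X →ₗ[ℝ] ℝ) × (X →ₗ[ℝ] ℝ) × (Q →ₗ[ℝ] ℝ) :=
    (momentumForm V R X Q G C d S α₁ ν τ).prod <| (inductionForm V R X Q c τ).prod <|
      (ohmForm V R X Q S α₂ σ η τ).prod <| (ampereForm V R X Q c).prod (divForm V R X Q d)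
  have hinj : Function.Injective T := by
    rw [← LinearMap.ker_eq_bot, LinearMap.ker_eq_bot']
    intro s hs
    exact eq_zero_of_homogeneous hG hS hd hα₁ hα₂ hν hσ hτ (congrArg (·.1) hs)
      (congrArg (·.2.1) hs) (congrArg (·.2.2.1) hs) (congrArg (·.2.2.2.1) hs)
      (congrArg (·.2.2.2.2) hs)
  have hrank : Module.finrank ℝ (V × Q × R × X × X) = Module.finrank ℝ
      ((V →ₗ[ℝ] ℝ) × (R →ₗ[ℝ] ℝ) × (X →ₗ[ℝ] ℝ) × (X →ₗ[ℝ] ℝ) × (Q →ₗ[ℝ] ℝ)) := by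
    simp only [Module.finrank_prod, Module.finrank_linearMap_self]
    ring
  have hbij : Function.Bijective T :=
    ⟨hinj, (LinearMap.injective_iff_surjective_of_finrank_eq_finrank hrank).1 hinj⟩
  -- The previous time level enters only through the difference quotients, which supply this
  -- right-hand side.
  let f : (V →ₗ[ℝ] ℝ) × (R →ₗ[ℝ] ℝ) × (X →ₗ[ℝ] ℝ) × (X →ₗ[ℝ] ℝ) × (Q →ₗ[ℝ] ℝ) :=
    (τ⁻¹ • ((innerₗ H (u₀ : H)).comp V.subtype) + (α₁ * τ⁻¹) • G u₀,
      τ⁻¹ • ((innerₗ H (B₀ : H)).comp R.subtype),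
      (α₂ * τ⁻¹) • ((innerₗ H (J₀ : H)).comp X.subtype), 0, 0)
  refine (existsUnique_congr fun s => ?_).1 (hbij.existsUnique f)
  simp only [Prod.ext_iff, LinearMap.ext_iff]
  refine and_congr (forall_congr' fun φ => ?_) (and_congr (forall_congr' fun ψ => ?_)
    (and_congr (forall_congr' fun χ => ?_) Iff.rfl))
  · rw [← sub_eq_zero]
    refine Eq.congr ?_ rfl
    simp [T, f, momentumForm, inner_sub_left]
    ring
  · rw [← sub_eq_zero]
    refine Eq.congr ?_ rfl
    simp [T, f, inductionForm, inner_sub_left]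
    ring
  · rw [← sub_eq_zero, ← sub_eq_zero (b := _ + _)]
    refine Eq.congr ?_ rfl
    simp [T, f, ohmForm, inner_sub_left]
    ring

end Abstract

/-! ### The terms of the scheme as linear operators on L² -/

section Operators

variable {D : Set Vec}

theorem memLp_multiplier {M : Vec → Vec →L[ℝ] Vec}
    (hM : AEStronglyMeasurable M (volume.restrict D))
    (hb : ∃ C, ∀ᵐ x ∂(volume.restrict D), ‖M x‖ ≤ C) (g : LTwo D Vec) :
    MemLp (fun x => M x (g x)) 2 (volume.restrict D) := by
  obtain ⟨C, hC⟩ := hb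
  refine (Lp.memLp g).of_le_mul (c := C) 
    ((ContinuousLinearMap.id ℝ (Vec →L[ℝ] Vec)).aestronglyMeasurable_comp₂ hM
      (Lp.aestronglyMeasurable g)) ?_
  filter_upwards [hC] with x hx
  exact (M x).le_of_opNorm_le hx _

/-- Pointwise application of a bounded field of linear maps, as an operator on `L²`. -/
def multiplier (M : Vec → Vec →L[ℝ] Vec) (hM : AEStronglyMeasurable M (volume.restrict D))
    (hb : ∃ C, ∀ᵐ x ∂(volume.restrict D), ‖M x‖ ≤ C) : LTwo D Vec →ₗ[ℝ] LTwo D Vec where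
  toFun g := (memLp_multiplier hM hb g).toLp _
  map_add' g h := by
    rw [← MemLp.toLp_add]
    refine MemLp.toLp_congr _ _ ?_
    filter_upwards [Lp.coeFn_add g h] with x hx
    rw [hx, Pi.add_apply, map_add]; rfl
  map_smul' c g := by
    rw [RingHom.id_apply, ← MemLp.toLp_const_smul]
    refine MemLp.toLp_congr _ _ ?_
    filter_upwards [Lp.coeFn_smul c g] with x hx
    rw [hx, Pi.smul_apply, map_smul]; rfl

theorem coeFn_multiplier {M : Vec → Vec →L[ℝ] Vec}
    (hM : AEStronglyMeasurable M (volume.restrict D))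
    (hb : ∃ C, ∀ᵐ x ∂(volume.restrict D), ‖M x‖ ≤ C) (g : LTwo D Vec) :
    ∀ᵐ x ∂(volume.restrict D), multiplier M hM hb g x = M x (g x) :=
  (memLp_multiplier hM hb g).coeFn_toLp

/-- The cross product with a bounded field on the right, as an operator on `L²`. -/
def crossOp (b : LTwo D Vec) (hb : ∃ C, ∀ᵐ x ∂(volume.restrict D), ‖b x‖ ≤ C) :
    LTwo D Vec →ₗ[ℝ] LTwo D Vec :=
  multiplier (fun x => crossCLM.flip (b x))
    (crossCLM.flip.continuous.comp_aestronglyMeasurable (Lp.aestronglyMeasurable b)) (by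
      obtain ⟨C, hC⟩ := hb
      refine ⟨‖crossCLM.flip‖ * C, ?_⟩
      filter_upwards [hC] with x hx
      exact crossCLM.flip.le_opNorm_of_le hx)

theorem inner_crossOp {b : LTwo D Vec} (hb : ∃ C, ∀ᵐ x ∂(volume.restrict D), ‖b x‖ ≤ C)
    (a v : LTwo D Vec) : inner ℝ (crossOp b hb a) v = crossInner D a b v := by
  rw [L2.inner_def, crossInner]
  refine integral_congr_ae ?_
  filter_upwards [coeFn_multiplier _ _ a] with x hx
  rw [crossOp, hx]; rfl

/-- The triple product is a determinant, so exchanging two arguments changes its sign. -/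
theorem inner_cross_swap (a b v : Vec) : inner ℝ (cross a b) v = - inner ℝ (cross v b) a := by
  simp [PiLp.inner_apply, Fin.sum_univ_three, cross, crossProduct]
  ring

theorem crossInner_swap (a b v : LTwo D Vec) :
    crossInner D a b v = - crossInner D v b a := by
  rw [crossInner, crossInner, ← integral_neg]
  exact integral_congr_ae (.of_forall fun x => inner_cross_swap _ _ _)

/-- The weak partial derivative as a linear map on a subspace of `H¹`. -/
def weakPartialₗ (hD : IsOpen D) (i : Fin 3) (V : Submodule ℝ (LTwo D Vec))
    (hV : ∀ v ∈ V, v ∈ HOne D) : V →ₗ[ℝ] LTwo D Vec where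
  toFun v := weakPartial D i v
  map_add' u v := weakPartial_add hD i (hV u u.2) (hV v v.2)
  map_smul' c v := weakPartial_smul hD i c (hV v v.2)

/-- The weak divergence as a linear map on a subspace of `H(div)`. -/
def weakDivₗ (hD : IsOpen D) (V : Submodule ℝ (LTwo D Vec))
    (hV : ∀ v ∈ V, v ∈ HDiv D) : V →ₗ[ℝ] LTwo D ℝ where
  toFun v := weakDiv D v
  map_add' u v := weakDiv_add hD (hV u u.2) (hV v v.2)
  map_smul' c v := weakDiv_smul hD c (hV v v.2)

/-- The weak curl as a linear map on a subspace of `H(curl)`. -/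
def weakCurlₗ (hD : IsOpen D) (V : Submodule ℝ (LTwo D Vec))
    (hV : ∀ v ∈ V, v ∈ HCurl D) : V →ₗ[ℝ] LTwo D Vec where
  toFun v := weakCurl D v
  map_add' u v := weakCurl_add hD (hV u u.2) (hV v v.2)
  map_smul' c v := weakCurl_smul hD c (hV v v.2)

/-- The form `⟨∇u, ∇v⟩` on a subspace of `H¹`. -/
def gradForm (hD : IsOpen D) (V : Submodule ℝ (LTwo D Vec)) (hV : ∀ v ∈ V, v ∈ HOne D) :
    V →ₗ[ℝ] V →ₗ[ℝ] ℝ :=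
  ∑ i, (innerₗ (LTwo D Vec)).compl₁₂ (weakPartialₗ hD i V hV) (weakPartialₗ hD i V hV)

theorem gradForm_apply (hD : IsOpen D) {V : Submodule ℝ (LTwo D Vec)}
    (hV : ∀ v ∈ V, v ∈ HOne D) (u v : V) : gradForm hD V hV u v = gradInner D u v := by
  simp [gradForm, gradInner, weakPartialₗ]

/-- The convection operator `u ↦ (w · ∇) u` of a bounded field `w`. -/
def convectOp (hD : IsOpen D) (V : Submodule ℝ (LTwo D Vec)) (hV : ∀ v ∈ V, v ∈ HOne D)
    (w : LTwo D Vec) (hw : ∃ C, ∀ᵐ x ∂(volume.restrict D), ‖w x‖ ≤ C) : V →ₗ[ℝ] LTwo D Vec :=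
  ∑ i, (multiplier (fun x => (coordCLM i (w x)) • ContinuousLinearMap.id ℝ Vec)
    (((coordCLM i).continuous.comp_aestronglyMeasurable
      (Lp.aestronglyMeasurable w)).smul_const _) (by
      obtain ⟨C, hC⟩ := hw
      refine ⟨‖coordCLM i‖ * C * ‖ContinuousLinearMap.id ℝ Vec‖, ?_⟩
      filter_upwards [hC] with x hx
      rw [norm_smul]
      gcongr
      exact (coordCLM i).le_opNorm_of_le hx)).comp (weakPartialₗ hD i V hV)

theorem inner_convectOp (hD : IsOpen D) {V : Submodule ℝ (LTwo D Vec)}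
    (hV : ∀ v ∈ V, v ∈ HOne D) {w : LTwo D Vec}
    (hw : ∃ C, ∀ᵐ x ∂(volume.restrict D), ‖w x‖ ≤ C) (u : V) (v : LTwo D Vec) :
    inner ℝ (convectOp hD V hV w hw u) v = convect D w u v := by
  rw [convectOp, LinearMap.sum_apply, sum_inner, convect]
  simp only [L2.inner_def]
  rw [← integral_finsetSum _ fun i _ => L2.integrable_inner _ _]
  refine integral_congr_ae ?_
  have h := fun i => coeFn_multiplier (D := D)
    (M := fun x => (coordCLM i (w x)) • ContinuousLinearMap.id ℝ Vec)
    (((coordCLM i).continuous.comp_aestronglyMeasurable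
      (Lp.aestronglyMeasurable w)).smul_const _) (by
      obtain ⟨C, hC⟩ := hw
      refine ⟨‖coordCLM i‖ * C * ‖ContinuousLinearMap.id ℝ Vec‖, ?_⟩
      filter_upwards [hC] with x hx
      rw [norm_smul]
      gcongr
      exact (coordCLM i).le_opNorm_of_le hx) (weakPartial D i u)
  filter_upwards [ae_all_iff.2 h] with x hx
  rw [sum_inner]
  refine Finset.sum_congr rfl fun i _ => ?_
  rw [LinearMap.comp_apply]
  exact congrArg (fun y => inner ℝ y (v x)) (hx i)

end Operators

/-! ### Solvability of a step and preservation of the divergence -/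

variable {D : Set Vec} {𝒯 : Geometry.SimplicialComplex ℝ Vec}

/-- Every time step is uniquely solvable. -/
theorem existsUnique_solvesStep (hD : IsOpen D) (hconn : IsConnected D)
    (hreg : interior (closure D) = D) (h𝒯 : IsTriangulation D 𝒯)
    {α₁ α₂ ν σ τ : ℝ} (η : ℝ) (hα₁ : 0 ≤ α₁) (hα₂ : 0 ≤ α₂) (hν : 0 < ν) (hσ : 0 ≤ σ)
    (hτ : 0 < τ) {old : State D} (hold : old ∈ YSpace D 𝒯) :
    ∃! new : State D, new ∈ YSpace D 𝒯 ∧ SolvesStep D 𝒯 α₁ α₂ ν σ η τ old new := by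
  have := h𝒯.isFiniteMeasure
  have := finiteDimensional_vZero h𝒯 hD
  have := finiteDimensional_qZero h𝒯 hD
  have := finiteDimensional_rtZero h𝒯 hD
  have := finiteDimensional_xZero h𝒯 hD
  obtain ⟨hu₀, -, hB₀, -, hJ₀⟩ := hold
  have hV : ∀ v ∈ vZeroSubmodule hD 𝒯, v ∈ HOne D := fun v hv => hv.2.1
  have hX : ∀ v ∈ xZeroSubmodule hD 𝒯, v ∈ HCurl D := fun v hv => hv.1.1
  -- Discrete fields are bounded, so convection by the old velocity and the cross product with the
  -- old magnetic field map into L².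
  have hw := ae_bounded_of_mem_VSpace h𝒯 hD hu₀.1
  have hb := ae_bounded_of_mem_RTSpace h𝒯 hD hB₀.1
  obtain ⟨⟨u, p, B, E, J⟩, ⟨e1, e2, e3, e4, e5⟩, huniq⟩ :=
    existsUnique_solution (V := vZeroSubmodule hD 𝒯) (R := rtZeroSubmodule hD 𝒯)
      (X := xZeroSubmodule hD 𝒯) (Q := qZeroSubmodule (D := D) 𝒯)
      (G := gradForm hD _ hV)
      (fun u => by
        rw [gradForm_apply]
        exact Finset.sum_nonneg fun i _ => real_inner_self_nonneg)
      (convectOp hD _ hV old.u hw)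
      (d := weakDivₗ hD _ fun v hv => HOne_subset_HDiv (hV v hv)) (weakCurlₗ hD _ hX)
      (S := crossOp old.B hb)
      (fun a b => by rw [inner_crossOp, inner_crossOp, crossInner_swap])
      (fun p hp => Subtype.ext (eq_zero_of_orthogonal_weakDiv h𝒯 hD hreg hconn p.2
        fun φ hφ => hp ⟨φ, hφ⟩))
      η hα₁ hα₂ hν hσ hτ ⟨old.u, hu₀⟩ ⟨old.B, hB₀⟩ ⟨old.J, hJ₀⟩
  -- `weakPartial` is linear only on H¹, so pulling out τ⁻¹ uses that the difference is again a
  -- discrete velocity.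
  have hgrad : ∀ u ∈ VZero D 𝒯, ∀ φ ∈ VZero D 𝒯,
      gradInner D (diffQuot τ u old.u) φ = τ⁻¹ * gradInner D (u - old.u) φ := by
    intro u hu φ hφ
    have hs := (vZeroSubmodule hD 𝒯).sub_mem hu hu₀
    have := congrArg (fun f => f ⟨φ, hφ⟩) ((gradForm hD _ hV).map_smul τ⁻¹ ⟨_, hs⟩)
    simp only [LinearMap.smul_apply, gradForm_apply] at this
    exact this
  have hinner : ∀ a b c : LTwo D Vec,
      inner ℝ (diffQuot τ a b) c = τ⁻¹ * inner ℝ (a - b) c := fun a b c =>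
    real_inner_smul_left _ _ _
  refine ⟨⟨u, p, B, E, J⟩, ⟨⟨u.2, p.2, B.2, E.2, J.2⟩, ?_⟩, ?_⟩
  · refine ⟨fun φ hφ => ?_, fun ψ hψ => ?_, fun χ hχ => ?_, fun ξ hξ => ?_, fun q hq => ?_⟩
    · have := e1 ⟨φ, hφ⟩
      simp only [gradForm_apply, inner_convectOp, inner_crossOp] at this
      rw [hgrad _ u.2 _ hφ, hinner]
      exact this
    · rw [hinner]
      exact e2 ⟨ψ, hψ⟩
    · have := e3 ⟨χ, hχ⟩
      simp only [inner_crossOp] at this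
      rw [hinner]
      exact this
    · exact e4 ⟨ξ, hξ⟩
    · exact e5 ⟨q, hq⟩
  · rintro ⟨u', p', B', E', J'⟩ ⟨⟨hu', hp', hB', hE', hJ'⟩, hs⟩
    have heq := huniq (⟨u', hu'⟩, ⟨p', hp'⟩, ⟨B', hB'⟩, ⟨E', hE'⟩, ⟨J', hJ'⟩)
      ⟨fun φ => by
        have := hs.momentum φ φ.2
        rw [hgrad _ hu' _ φ.2, hinner] at this
        simp only [gradForm_apply, inner_convectOp, inner_crossOp]
        exact this,
      fun ψ => by
        have := hs.induction ψ ψ.2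
        rw [hinner] at this
        exact this,
      fun χ => by
        have := hs.ohm χ χ.2
        rw [hinner] at this
        simp only [inner_crossOp]
        exact this,
      fun ξ => hs.ampere ξ ξ.2, fun q => hs.incompressible q q.2⟩
    exact State.ext (congrArg (fun s => (s.1 : LTwo D Vec)) heq)
      (congrArg (fun s => (s.2.1 : LTwo D ℝ)) heq) (congrArg (fun s => (s.2.2.1 : LTwo D Vec)) heq)
      (congrArg (fun s => (s.2.2.2.1 : LTwo D Vec)) heq)
      (congrArg (fun s => (s.2.2.2.2 : LTwo D Vec)) heq)

/-- A time step preserves the divergence of the magnetic field. -/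
theorem SolvesStep.weakDiv_eq (hD : IsOpen D) (hreg : interior (closure D) = D)
    (h𝒯 : IsTriangulation D 𝒯) {α₁ α₂ ν σ η τ : ℝ} (hτ : 0 < τ) {old new : State D}
    (hold : old ∈ YSpace D 𝒯) (hnew : new ∈ YSpace D 𝒯)
    (hs : SolvesStep D 𝒯 α₁ α₂ ν σ η τ old new) : weakDiv D new.B = weakDiv D old.B := by
  obtain ⟨-, -, hB, hE, -⟩ := hnew
  have hB₀ := hold.2.2.1
  have hcurl := weakCurl_mem_RTZero h𝒯 hD hreg hE
  have hmem : diffQuot τ new.B old.B + weakCurl D new.E ∈ RTZero D 𝒯 :=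
    (rtZeroSubmodule hD 𝒯).add_mem
      ((rtZeroSubmodule hD 𝒯).smul_mem _ ((rtZeroSubmodule hD 𝒯).sub_mem hB hB₀)) hcurl
  -- The residual lies in the test space, so testing with itself shows that its norm is zero.
  have hzero : diffQuot τ new.B old.B + weakCurl D new.E = 0 := by
    have := hs.induction _ hmem
    rw [← inner_add_left] at this
    exact inner_self_eq_zero.1 this
  have hBeq : new.B = old.B + (-τ) • weakCurl D new.E := by
    have h1 : weakCurl D new.E = -(τ⁻¹ • (new.B - old.B)) :=
      eq_neg_of_add_eq_zero_right hzero
    rw [h1, smul_neg, neg_smul, neg_neg, smul_smul, mul_inv_cancel₀ hτ.ne', one_smul]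
    abel
  rw [hBeq, weakDiv_add hD hB₀.1.1 ((hDivZeroSubmodule hD).smul_mem _ hcurl.2).1,
    weakDiv_smul hD _ hcurl.1.1, weakDiv_weakCurl hD hE.2, smul_zero, add_zero]

end

end HallMHD

end

theorem proposition3p1
    -- a bounded (by the triangulation) polytopal domain
    (D : Set Vec) (hD_open : IsOpen D) (hD_conn : IsConnected D)
    (hD_reg : interior (closure D) = D)
    (𝒯 : Geometry.SimplicialComplex ℝ Vec) (h𝒯 : IsTriangulation D 𝒯)
    (α₁ α₂ ν σ η τ : ℝ) (hα₁ : 0 ≤ α₁) (hα₂ : 0 ≤ α₂) (hν : 0 < ν) (hσ : 0 ≤ σ) (hη : 0 < η)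
    (hτ : 0 < τ) :
    -- each step is uniquely solvable
    (∀ old ∈ YSpace D 𝒯,
      ∃! new : State D, new ∈ YSpace D 𝒯 ∧ SolvesStep D 𝒯 α₁ α₂ ν σ η τ old new) ∧
    -- the divergence of the magnetic field is preserved along the scheme
    (∀ (N : ℕ) (s : ℕ → State D), s 0 ∈ YSpace D 𝒯 →
      (∀ n, 1 ≤ n → n ≤ N →
        s n ∈ YSpace D 𝒯 ∧ SolvesStep D 𝒯 α₁ α₂ ν σ η τ (s (n - 1)) (s n)) →
      ∀ n, 1 ≤ n → n ≤ N →
        weakDiv D (s n).B = weakDiv D (s 0).B ∧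
        (weakDiv D (s 0).B = 0 → weakDiv D (s n).B = 0)) := by
  refine ⟨fun old hold => existsUnique_solvesStep hD_open hD_conn hD_reg h𝒯 η hα₁ hα₂ hν hσ hτ hold,
    fun N s h0 hs => ?_⟩
  have hmem : ∀ n, n ≤ N → s n ∈ YSpace D 𝒯 := fun n hn => by
    rcases Nat.eq_zero_or_pos n with rfl | hpos
    · exact h0
    · exact (hs n hpos hn).1
  have hdiv : ∀ n, n ≤ N → weakDiv D (s n).B = weakDiv D (s 0).B := fun n => by
    induction n with
    | zero => exact fun _ => rfl
    | succ k ih =>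
      intro hn
      rw [← ih (by omega)]
      exact (hs (k + 1) (by omega) hn).2.weakDiv_eq hD_open hD_reg h𝒯 hτ
        (hmem k (by omega)) (hmem (k + 1) hn)
  exact fun n _ hn => ⟨hdiv n hn, fun h => (hdiv n hn).trans h⟩
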